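/- **Setting.** Let $p\ge 1$, $B>0$, $C>0$, $r>0$, $\delta\in(0,1)$. Write $\mathcal B(R)$ for the closed centred Euclidean ball of radius $R$ in $\mathbb R^p$. Let $\theta^\star\in\mathcal B(B)$ and let $(\mathcal X_t)_{t\ge1}$ be deterministic decision sets with $\mathcal X_t\subseteq\mathcal B(1)$. In round $t$ an arm $X_t\in\mathcal X_t$ is played and the reward $Y_t=\langle\theta^\star,X_t\rangle+\varepsilon_t$ is observed. The regret is $\mathrm{Reg}(T)=\sum_{t=1}^T\sup_{x\in\mathcal X_t}\big(\langle x,\theta^\star\rangle-\langle X_t,\theta^\star\rangle\big)$. **Noise.** Let $\mathcal F_t=\sigma(\varepsilon_1,\dots,\varepsilon_t)$. The noise is algebraically mixing (sub-Gaussian with $\sigma=1$) with $\phi_d=Cd^{-r}$: every $\varepsilon_t$ is centred and $1$-sub-Gaussian, and for all $d\ge1$, $t>d$, almost surely, $$\big|\mathbb E[\varepsilon_t\mid\mathcal F_{t-d}]\big|\le\phi_d,\qquad \mathbb E\big[e^{\lambda(\varepsilon_t-\mathbb E[\varepsilon_t\mid\mathcal F_{t-d}])}\mid\mathcal F_{t-d}\big]\le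 e^{\lambda^2/2}\quad\text{for all }\lambda\in\mathbb R.$$ **Algorithm (Mixing-LinUCB with delay $d\ge1$).** Let $V_t=\sum_{s=1}^tX_sX_s^\top+B^{-2}\mathrm{Id}$, let $\widehat\theta_t$ be a minimiser of $\sum_{s=1}^t(\langle\theta,X_s\rangle-Y_s)^2$ over $\theta\in\mathcal B(B)$, and let $$\mathcal C_t=\Big\{\theta\in\mathcal B(B):\tfrac12\|\theta-\widehat\theta_t\|_{V_t}^2\le\tfrac{dp}2\log\tfrac{(B+1)^2e\max(dp,t+d)}{dp}+2+t\phi_d(B+1)+d\log\tfrac d\delta\Big\}.$$ The arms $X_1,\dots,X_d$ are arbitrary but deterministic; for $t>d$, $X_t$ is an $\mathcal F_{t-d}$-measurable maximiser of $x\mapsto\max_{\theta\in\mathcal C_{t-d}}\langle x,\theta\rangle$ over $\mathcal X_t$. **Corollary 3.** Suppose that the noise is algebraically mixing with $\phi_d=Cd^{-r}$ and that Mixing-LinUCB is run with $d=\lceil CT^{1/(1+r)}\rceil$. Then, with probability at least $1-\delta$, $$\mathrm{Reg}(T)=\mathcal O(\rho_T),\qquad \rho_T=CBT^{\frac1{1+r}}+CT^{\frac{3+r}{2(1+r)}}\Big(p\log\tfrac{TB}p+\sqrt{Bp\log\tfrac{T^{r/(1+r)}B}{Cp}}+\sqrt{p\log\tfrac{TB}{p\delta}}\Big)$$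 as $T\to\infty$. Precisely: there is an absolute constant $K>0$ such that for all $p,B,C,r,\delta$ as above there is a $T_0$, depending only on $(p,B,C,r,\delta)$, such that for every $T\ge T_0$, all decision sets, all $\theta^\star\in\mathcal B(B)$, all algebraically mixing noises and all runs of the algorithm, $\mathbb P(\mathrm{Reg}(T)\le K\rho_T)\ge1-\delta$. If $r>1$, this is sublinear: $\rho_T=o(T)$, and hence for every $\eta>0$ there is a $T_0$ depending only on $(p,B,C,r,\delta,\eta)$ such that $\mathbb P(\mathrm{Reg}(T)\le\eta T)\ge1-\delta$ for every $T\ge T_0$, uniformly over all instances as above. -/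

import Mathlib

open MeasureTheory ProbabilityTheory
open scoped NNReal

universe u

/-- The `σ`-field `ℱ_t = σ(ε_1, …, ε_t)` generated by the first `t` noise variables
(the trivial `σ`-field for `t = 0`). -/
@[reducible] def noiseField {Ω : Type*} (ε : ℕ → Ω → ℝ) (t : ℕ) : MeasurableSpace Ω :=
  ⨆ s ∈ Set.Icc 1 t, MeasurableSpace.comap (ε s) (inferInstance : MeasurableSpace ℝ)

/-- The noise `(ε_t)_{t ≥ 1}` is `(σ, φ)`-mixing sub-Gaussian. The delay `d` ranges over `d ≥ 1`:
for `d = 0` the conditional mean given `ℱ_t` is `ε_t` itself, and a rate such as `C d ^ (-r)`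
imposes nothing there (it is infinite). -/
structure IsMixingSubGaussian {Ω : Type*} [MeasurableSpace Ω] (μ : Measure Ω)
    (σ : ℝ≥0) (φ : ℕ → ℝ) (ε : ℕ → Ω → ℝ) : Prop where
  rate_nonneg : ∀ d, 1 ≤ d → 0 ≤ φ d
  rate_antitone : AntitoneOn φ (Set.Ici 1)
  measurable : ∀ t, 1 ≤ t → Measurable (ε t)
  centred : ∀ t, 1 ≤ t → ∫ ω, ε t ω ∂μ = 0
  subGaussian : ∀ t, 1 ≤ t → HasSubgaussianMGF (ε t) (σ ^ 2) μ
  cond_mean : ∀ d t, 1 ≤ d → d < t →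
    ∀ᵐ ω ∂μ, |(μ[ε t | noiseField ε (t - d)]) ω| ≤ φ d
  cond_subGaussian : ∀ d t, 1 ≤ d → d < t → ∀ l : ℝ,
    ∀ᵐ ω ∂μ, (μ[fun ω' => Real.exp (l * (ε t ω' - (μ[ε t | noiseField ε (t - d)]) ω'))
      | noiseField ε (t - d)]) ω ≤ Real.exp (l ^ 2 * (σ : ℝ) ^ 2 / 2)

/-- The algebraic mixing rate `φ_d = C d ^ (-r)`, for `d ≥ 1`. -/
noncomputable def algebraicRate (C r : ℝ) (d : ℕ) : ℝ := C * (d : ℝ) ^ (-r)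

/-- The feature-covariance matrix `V_t = ∑_{s ≤ t} x_s x_sᵀ + lam Id`. -/
noncomputable def featureCov {p : ℕ} (lam : ℝ) (x : ℕ → EuclideanSpace ℝ (Fin p)) (t : ℕ) :
    Matrix (Fin p) (Fin p) ℝ :=
  ∑ s ∈ Finset.Icc 1 t, Matrix.vecMulVec (x s).ofLp (x s).ofLp + lam • 1

/-- The squared weighted norm `‖u‖_A² = ⟨u, A u⟩`. -/
noncomputable def weightedNormSq {p : ℕ} (A : Matrix (Fin p) (Fin p) ℝ)
    (u : EuclideanSpace ℝ (Fin p)) : ℝ :=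
  dotProduct u.ofLp (A.mulVec u.ofLp)

/-- `θ` is a least-squares estimator over the ball of radius `B`, from the first `t` rounds. -/
def IsLeastSquares {p : ℕ} (B : ℝ) (x : ℕ → EuclideanSpace ℝ (Fin p)) (y : ℕ → ℝ) (t : ℕ)
    (θ : EuclideanSpace ℝ (Fin p)) : Prop :=
  θ ∈ Metric.closedBall 0 B ∧
    IsMinOn (fun θ' => ∑ s ∈ Finset.Icc 1 t, (inner ℝ θ' (x s) - y s) ^ 2)
      (Metric.closedBall 0 B) θ

/-- The confidence set `𝒞_t` with centre `θhat`, delay `d`, mixing rate `φ`, level `δ` and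
regularisation `lam`. -/
def confidenceSet {p : ℕ} (B lam δ : ℝ) (φ : ℕ → ℝ) (d : ℕ)
    (x : ℕ → EuclideanSpace ℝ (Fin p)) (t : ℕ) (θhat : EuclideanSpace ℝ (Fin p)) :
    Set (EuclideanSpace ℝ (Fin p)) :=
  {θ | θ ∈ Metric.closedBall 0 B ∧
    1 / 2 * weightedNormSq (featureCov lam x t) (θ - θhat) ≤
      (d : ℝ) * p / 2 *
          Real.log ((B + 1) ^ 2 * Real.exp 1 * max ((d : ℝ) * p) ((t : ℝ) + d) / ((d : ℝ) * p))
        + 2 * lam * B ^ 2 + t * φ d * (B + 1) + d * Real.log (d / δ)}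

/-- The upper confidence bound `UCB_𝒞(x) = max_{θ ∈ 𝒞} ⟨x, θ⟩`. -/
noncomputable def ucb {p : ℕ} (S : Set (EuclideanSpace ℝ (Fin p)))
    (x : EuclideanSpace ℝ (Fin p)) : ℝ :=
  sSup ((fun θ => inner ℝ x θ) '' S)

/-- The reward `Y_t = ⟨θ⋆, X_t⟩ + ε_t`. -/
noncomputable def reward {p : ℕ} {Ω : Type*} (θstar : EuclideanSpace ℝ (Fin p))
    (ε : ℕ → Ω → ℝ) (X : ℕ → Ω → EuclideanSpace ℝ (Fin p)) (t : ℕ) (ω : Ω) : ℝ :=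
  inner ℝ θstar (X t ω) + ε t ω

/-- The arms `X` are those played by Mixing-LinUCB with delay `d` on the decision sets `D`: the
first `d` arms are arbitrary but fixed; afterwards `X_t` maximises the upper confidence bound of
`𝒞_{t-d}` over `D t`, ties being broken as a function of the noise of the first `t - d` rounds.
`θhat t` is any least-squares estimator from the first `t` rounds. -/
structure IsMixingLinUCB {p : ℕ} {Ω : Type*} (B lam δ : ℝ) (φ : ℕ → ℝ) (d : ℕ)
    (D : ℕ → Set (EuclideanSpace ℝ (Fin p))) (θstar : EuclideanSpace ℝ (Fin p))
    (ε : ℕ → Ω → ℝ) (X θhat : ℕ → Ω → EuclideanSpace ℝ (Fin p)) : Prop where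
  initial : ∀ t, 1 ≤ t → t ≤ d → ∃ x ∈ D t, ∀ ω, X t ω = x
  leastSquares : ∀ t, 1 ≤ t → ∀ ω,
    IsLeastSquares B (fun s => X s ω) (fun s => reward θstar ε X s ω) t (θhat t ω)
  arm_mem : ∀ t, d < t → ∀ ω, X t ω ∈ D t
  optimistic : ∀ t, d < t → ∀ ω,
    IsMaxOn (ucb (confidenceSet B lam δ φ d (fun s => X s ω) (t - d) (θhat (t - d) ω)))
      (D t) (X t ω)
  adapted : ∀ t, d < t → Measurable[noiseField ε (t - d)] (X t)

/-- The regret `Reg(T) = ∑_{t=1}^T sup_{x ∈ D t} (⟨x, θ⋆⟩ - ⟨X_t, θ⋆⟩)`. -/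
noncomputable def regret {p : ℕ} {Ω : Type*} (D : ℕ → Set (EuclideanSpace ℝ (Fin p)))
    (θstar : EuclideanSpace ℝ (Fin p)) (X : ℕ → Ω → EuclideanSpace ℝ (Fin p))
    (T : ℕ) (ω : Ω) : ℝ :=
  ∑ t ∈ Finset.Icc 1 T,
    sSup ((fun x => inner ℝ x θstar - inner ℝ (X t ω) θstar) '' D t)

/-- The delay `d = ⌈C T ^ (1 / (1 + r))⌉`. -/
noncomputable def algebraicDelay (C r : ℝ) (T : ℕ) : ℕ := ⌈C * (T : ℝ) ^ (1 / (1 + r))⌉₊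

/-- `R` is a worst-case regret bound at horizon `T` and confidence level `1 - δ` under algebraic
mixing: for all decision sets in the unit ball, all parameters `θ⋆` in the ball of radius `B`,
all algebraically mixing noises, and all arms played by Mixing-LinUCB (with `lam = 1 / B ^ 2` and
`d = ⌈C T ^ (1 / (1 + r))⌉`), one has `Reg(T) ≤ R` with probability at least `1 - δ`. -/
def IsWorstCaseRegretBound (p : ℕ) (B C r δ : ℝ) (T : ℕ) (R : ℝ) : Prop :=
  ∀ (Ω : Type u) [MeasurableSpace Ω] (μ : Measure Ω) [IsProbabilityMeasure μ]
    (D : ℕ → Set (EuclideanSpace ℝ (Fin p))) (θstar : EuclideanSpace ℝ (Fin p))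
    (ε : ℕ → Ω → ℝ) (X θhat : ℕ → Ω → EuclideanSpace ℝ (Fin p)),
    (∀ t, 1 ≤ t → D t ⊆ Metric.closedBall 0 1) →
    θstar ∈ Metric.closedBall 0 B →
    IsMixingSubGaussian μ 1 (algebraicRate C r) ε →
    IsMixingLinUCB B (1 / B ^ 2) δ (algebraicRate C r) (algebraicDelay C r T) D θstar ε X θhat →
    ENNReal.ofReal (1 - δ) ≤ μ {ω | regret D θstar X T ω ≤ R}

/-- The rate `C B T^(1/(1+r)) + C T^((3+r)/(2(1+r))) (p log(TB/p)
+ √(B p log(T^(r/(1+r)) B/(Cp))) + √(p log(TB/(pδ))))`. -/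
noncomputable def algebraicRegretRate (p : ℕ) (B C r δ : ℝ) (T : ℕ) : ℝ :=
  C * B * (T : ℝ) ^ (1 / (1 + r))
    + C * (T : ℝ) ^ ((3 + r) / (2 * (1 + r))) *
      (p * Real.log (T * B / p)
        + √(B * p * Real.log ((T : ℝ) ^ (r / (1 + r)) * B / (C * p)))
        + √(p * Real.log (T * B / (p * δ))))

/-! The rounds are split into `d` residue classes modulo `d`. Inside one class, consecutive rounds
are `d` apart, so the arm `X_s` and the bias `b_s = 𝔼[ε_s | ℱ_{s-d}]` are known when the preceding
round of the class ends, and `ε_s - b_s` is conditionally sub-Gaussian. For each fixed `θ`, the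
Gaussian likelihood ratio of `θ` against `θ⋆` along the class is therefore a supermartingale.
Averaging it over a uniform prior on the ball of radius `B + 1` and applying Ville's inequality at
level `d / δ` controls every class at once with probability `1 - δ`
(`IsMixingSubGaussian.measure_residueMixture_lt`).

The mixture is bounded below by the likelihood ratio at any point of the ball of radius `B`, hence
at the random `θhat`, up to the cost of a small ball of radius `c`
(`sum_le_of_lintegral_likelihoodRatio_lt`). With the optimality of least squares this gives `D / 2 ≤
R + φ_d U`, where `D` and `U` sum the squares and the absolute values of `⟨θhat - θ⋆, X_s⟩`. The
crude bound `U ≤ 2 B t` exceeds the allowance `t (B + 1)` of the confidence set when `B > 1`;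
`mem_confidenceSet_of_sum_le` closes this gap for small `φ_d` by a dichotomy on the size of `D`.

Once `θ⋆` lies in the confidence sets, optimism bounds the regret of a round by the width of its
confidence set. Keeping only the covariance of the round's own class makes the elliptical potential
lemma applicable to each class, and Cauchy–Schwarz over all rounds gives `2 B d + O(√(T d b p log))`
with squared radius `b` (`IsMixingLinUCB.regret_le`). The delay makes `T φ_d` of order `d`, so `b`
is of order `d p log T` and the regret of order `d p √T log T`. -/

section FeatureCovariance

/-! ### Weighted norms, determinants and the elliptical potential. -/

variable {p : ℕ} {lam : ℝ} {x : ℕ → EuclideanSpace ℝ (Fin p)}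

lemma inner_eq_dotProduct (u v : EuclideanSpace ℝ (Fin p)) :
    inner ℝ u v = dotProduct u.ofLp v.ofLp := by
  rw [EuclideanSpace.inner_eq_star_dotProduct, star_trivial, dotProduct_comm]

lemma weightedNormSq_featureCov (t : ℕ) (u : EuclideanSpace ℝ (Fin p)) :
    weightedNormSq (featureCov lam x t) u =
      ∑ s ∈ Finset.Icc 1 t, (inner ℝ u (x s)) ^ 2 + lam * ‖u‖ ^ 2 := by
  unfold weightedNormSq featureCov
  rw [Matrix.add_mulVec, dotProduct_add, Matrix.sum_mulVec, dotProduct_sum]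
  congr 1
  · refine Finset.sum_congr rfl fun s _ => ?_
    rw [Matrix.vecMulVec_mulVec, inner_eq_dotProduct]
    simp [dotProduct_comm (x s).ofLp u.ofLp, sq]
  · rw [Matrix.smul_mulVec, Matrix.one_mulVec, dotProduct_smul, ← inner_eq_dotProduct,
      real_inner_self_eq_norm_sq, smul_eq_mul]

lemma featureCov_zero : featureCov lam x 0 = lam • 1 := by
  simp [featureCov]

lemma featureCov_succ (t : ℕ) :
    featureCov lam x (t + 1) =
      featureCov lam x t + Matrix.vecMulVec (x (t + 1)).ofLp (x (t + 1)).ofLp := by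
  unfold featureCov
  rw [Finset.sum_Icc_succ_top (by omega)]
  abel

lemma featureCov_posDef (hlam : 0 < lam) (t : ℕ) : (featureCov lam x t).PosDef := by
  induction t with
  | zero => rw [featureCov_zero]; exact Matrix.PosDef.one.smul hlam
  | succ t ih =>
    rw [featureCov_succ]
    refine ih.add_posSemidef ?_
    simpa using Matrix.posSemidef_vecMulVec_self_star (x (t + 1)).ofLp

lemma trace_featureCov_le (hx : ∀ s, 1 ≤ s → ‖x s‖ ≤ 1) (t : ℕ) :
    (featureCov lam x t).trace ≤ t + p * lam := by
  induction t with
  | zero => simp [featureCov_zero, mul_comm]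
  | succ t ih =>
    rw [featureCov_succ, Matrix.trace_add, Matrix.trace_vecMulVec, ← inner_eq_dotProduct,
      real_inner_self_eq_norm_sq]
    have := pow_le_one₀ (n := 2) (norm_nonneg _) (hx (t + 1) (by omega))
    push_cast
    linarith

/-- Each eigenvalue is at most the trace. This is weaker than the AM–GM bound, but the loss stays
inside a logarithm. -/
lemma Matrix.PosDef.det_le_trace_pow {A : Matrix (Fin p) (Fin p) ℝ} (hA : A.PosDef) :
    A.det ≤ A.trace ^ p := by
  have h0 : ∀ i, 0 ≤ hA.isHermitian.eigenvalues i := fun i => (hA.eigenvalues_pos i).le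
  have h1 := hA.isHermitian.det_eq_prod_eigenvalues
  have h2 := hA.isHermitian.trace_eq_sum_eigenvalues
  simp only [RCLike.ofReal_real_eq_id, id_eq] at h1 h2
  rw [h1, h2]
  calc ∏ i, hA.isHermitian.eigenvalues i
      ≤ ∏ _i : Fin p, ∑ j, hA.isHermitian.eigenvalues j :=
        Finset.prod_le_prod (fun i _ => h0 i)
          fun i _ => Finset.single_le_sum (fun j _ => h0 j) (Finset.mem_univ i)
    _ = _ := by simp

lemma weightedNormSq_sub_smul {A : Matrix (Fin p) (Fin p) ℝ} (hA : A.IsHermitian)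
    (u w : EuclideanSpace ℝ (Fin p)) (s : ℝ) :
    weightedNormSq A (u - s • w) = weightedNormSq A u
      - 2 * s * dotProduct u.ofLp (A.mulVec w.ofLp) + s ^ 2 * weightedNormSq A w := by
  have hsym : dotProduct w.ofLp (A.mulVec u.ofLp) = dotProduct u.ofLp (A.mulVec w.ofLp) := by
    have : A.transpose = A := by simpa [Matrix.IsHermitian] using hA
    rw [Matrix.dotProduct_mulVec, ← Matrix.mulVec_transpose, this, dotProduct_comm]
  unfold weightedNormSq
  simp only [WithLp.ofLp_sub, WithLp.ofLp_smul, Matrix.mulVec_sub, Matrix.mulVec_smul,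
    dotProduct_sub, sub_dotProduct, dotProduct_smul, smul_dotProduct, smul_eq_mul, hsym]
  ring

lemma weightedNormSq_nonneg {A : Matrix (Fin p) (Fin p) ℝ} (hA : A.PosDef)
    (u : EuclideanSpace ℝ (Fin p)) : 0 ≤ weightedNormSq A u := by
  simpa [weightedNormSq] using hA.posSemidef.dotProduct_mulVec_nonneg u.ofLp

lemma mulVec_inv_mulVec {A : Matrix (Fin p) (Fin p) ℝ} (hA : A.PosDef) (v : Fin p → ℝ) :
    A.mulVec (A⁻¹.mulVec v) = v := by
  rw [Matrix.mulVec_mulVec, Matrix.mul_nonsing_inv _ ((Matrix.isUnit_iff_isUnit_det A).1 hA.isUnit),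
    Matrix.one_mulVec]

/-- Cauchy–Schwarz between a positive definite quadratic form and its dual. -/
lemma sq_inner_le_weightedNormSq_inv_mul {A : Matrix (Fin p) (Fin p) ℝ} (hA : A.PosDef)
    (u v : EuclideanSpace ℝ (Fin p)) :
    (inner ℝ u v) ^ 2 ≤ weightedNormSq A⁻¹ v * weightedNormSq A u := by
  set w : EuclideanSpace ℝ (Fin p) := WithLp.toLp 2 (A⁻¹.mulVec v.ofLp) with hw
  have hAw : A.mulVec w.ofLp = v.ofLp := mulVec_inv_mulVec hA _
  have hww : weightedNormSq A w = weightedNormSq A⁻¹ v := by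
    unfold weightedNormSq
    rw [hAw, dotProduct_comm]
  -- The quadratic in `s` is `‖u - s A⁻¹ v‖_A²`; its discriminant is nonpositive.
  have key : ∀ s : ℝ, 0 ≤ weightedNormSq A⁻¹ v * (s * s) + (-2 * inner ℝ u v) * s
      + weightedNormSq A u := fun s => by
    have h := weightedNormSq_nonneg hA (u - s • w)
    rw [weightedNormSq_sub_smul hA.isHermitian, hAw, hww, ← inner_eq_dotProduct] at h
    linarith
  have := discrim_le_zero key
  rw [discrim] at this
  nlinarith

/-- The matrix determinant lemma for a rank-one update. It makes the logarithms of the potential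
terms telescope. -/
lemma det_featureCov_succ (hlam : 0 < lam) (t : ℕ) :
    (featureCov lam x (t + 1)).det = (featureCov lam x t).det *
      (1 + weightedNormSq (featureCov lam x t)⁻¹ (x (t + 1))) := by
  have hu := (Matrix.isUnit_iff_isUnit_det _).1 (featureCov_posDef (x := x) hlam t).isUnit
  rw [featureCov_succ, Matrix.vecMulVec_eq Unit,
    Matrix.det_add_replicateCol_mul_replicateRow hu, weightedNormSq, Matrix.det_unique (n := Unit)]
  congr 1
  simp only [Matrix.add_apply, Matrix.one_apply_eq]
  rw [Matrix.mul_assoc, ← Matrix.replicateCol_mulVec, Matrix.replicateRow_mul_replicateCol_apply]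

lemma min_one_le_two_mul_log {y : ℝ} (hy : 0 ≤ y) : min 1 y ≤ 2 * Real.log (1 + y) := by
  have h1 : 0 ≤ min 1 y := le_min zero_le_one hy
  have h2 := Real.one_sub_inv_le_log_of_pos (show 0 < 1 + min 1 y by linarith)
  have h3 : Real.log (1 + min 1 y) ≤ Real.log (1 + y) :=
    Real.log_le_log (by linarith) (by linarith [min_le_right 1 y])
  have h4 : min 1 y / 2 ≤ 1 - (1 + min 1 y)⁻¹ := by
    have h5 := min_le_left 1 y
    have : 1 - (1 + min 1 y)⁻¹ = min 1 y / (1 + min 1 y) := by field_simp; ring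
    rw [this]
    exact div_le_div_of_nonneg_left h1 (by linarith) (by linarith)
  linarith

/-- The elliptical potential lemma. -/
lemma sum_min_one_weightedNormSq_inv_le (hlam : 0 < lam) (hx : ∀ s, 1 ≤ s → ‖x s‖ ≤ 1)
    (hp : 1 ≤ p) (n : ℕ) :
    ∑ k ∈ Finset.range n, min 1 (weightedNormSq (featureCov lam x k)⁻¹ (x (k + 1))) ≤
      2 * p * Real.log (p + n / lam) := by
  have hpos : ∀ k, 0 < (featureCov lam x k).det := fun k => (featureCov_posDef hlam k).det_pos
  have htel : ∑ k ∈ Finset.range n, min 1 (weightedNormSq (featureCov lam x k)⁻¹ (x (k + 1))) ≤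
      2 * (Real.log (featureCov lam x n).det - Real.log (featureCov lam x 0).det) := by
    induction n with
    | zero => simp
    | succ n ih =>
      have h0 : 0 ≤ weightedNormSq (featureCov lam x n)⁻¹ (x (n + 1)) :=
        weightedNormSq_nonneg (featureCov_posDef hlam n).inv _
      rw [Finset.sum_range_succ, det_featureCov_succ hlam,
        Real.log_mul (hpos n).ne' (by linarith)]
      linarith [min_one_le_two_mul_log h0]
  refine htel.trans ?_
  have hp' : (1 : ℝ) ≤ p := by exact_mod_cast hp
  have htr : 0 < (n : ℝ) + p * lam := by positivity
  have htr0 : 0 ≤ (featureCov lam x n).trace :=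
    (featureCov_posDef hlam n).posSemidef.trace_nonneg
  have h1 : Real.log (featureCov lam x n).det ≤ p * Real.log (n + p * lam) := by
    rw [← Real.log_pow]
    exact Real.log_le_log (hpos n) ((featureCov_posDef hlam n).det_le_trace_pow.trans
      (pow_le_pow_left₀ htr0 (trace_featureCov_le hx n) _))
  have h2 : Real.log (featureCov lam x 0).det = p * Real.log lam := by
    rw [featureCov_zero, Matrix.det_smul, Matrix.det_one, Fintype.card_fin, mul_one, Real.log_pow]
  have h3 : (p : ℝ) + n / lam = (n + p * lam) / lam := by field_simp; ring
  rw [h2, h3, Real.log_div htr.ne' hlam.ne']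
  linarith

end FeatureCovariance
-- Residue classes of rounds.
/-- Splitting the rounds `1, …, t` into residue classes modulo `d`. -/
lemma sum_Icc_eq_sum_residues {M : Type*} [AddCommMonoid M] {d : ℕ} (hd : 1 ≤ d) (t : ℕ)
    (f : ℕ → M) :
    ∑ s ∈ Finset.Icc 1 t, f s =
      ∑ i ∈ Finset.range d, ∑ k ∈ Finset.range ((t + d - 1 - i) / d), f (i + 1 + k * d) := by
  rw [Finset.sum_sigma']
  -- `(t + d - 1 - i) / d` is `(t - i) / d` rounded up: the number of rounds `i + 1 + k * d` up to
  -- `t`.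
  refine Finset.sum_bij' (fun s _ => ⟨(s - 1) % d, (s - 1) / d⟩) (fun q _ => q.1 + 1 + q.2 * d)
    ?_ ?_ ?_ ?_ ?_
  · intro s hs
    have h := Nat.mod_add_div' (s - 1) d
    have hm := Nat.mod_lt (s - 1) (show 0 < d by omega)
    simp only [Finset.mem_Icc, Finset.mem_sigma, Finset.mem_range] at hs ⊢
    refine ⟨hm, ?_⟩
    rw [Nat.lt_iff_add_one_le, Nat.le_div_iff_mul_le (by omega), add_mul, one_mul]
    omega
  · rintro ⟨i, k⟩ hq
    simp only [Finset.mem_Icc, Finset.mem_sigma, Finset.mem_range] at hq ⊢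
    obtain ⟨hi, hk⟩ := hq
    rw [Nat.lt_iff_add_one_le, Nat.le_div_iff_mul_le (by omega), add_mul, one_mul] at hk
    omega
  · intro s hs
    have h := Nat.mod_add_div' (s - 1) d
    simp only [Finset.mem_Icc] at hs ⊢
    omega
  · rintro ⟨i, k⟩ hq
    simp only [Finset.mem_sigma, Finset.mem_range] at hq
    have h : i + 1 + k * d - 1 = i + k * d := by omega
    simp only [h, Nat.add_mul_mod_self_right, Nat.mod_eq_of_lt hq.1,
      Nat.add_mul_div_right _ _ (show 0 < d by omega), Nat.div_eq_of_lt hq.1, zero_add]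
  · intro s hs
    have h := Nat.mod_add_div' (s - 1) d
    simp only [Finset.mem_Icc] at hs ⊢
    congr 1
    omega

lemma residue_round_le {d : ℕ} (hd : 1 ≤ d) {t i k : ℕ} (hi : i < d)
    (hk : k < (t + d - 1 - i) / d) : i + 1 + k * d ≤ t := by
  rw [Nat.lt_iff_add_one_le, Nat.le_div_iff_mul_le (by omega), add_mul, one_mul] at hk
  omega

lemma residue_count_le {d : ℕ} (hd : 1 ≤ d) (t i : ℕ) : (t + d - 1 - i) / d ≤ t := by
  rw [← Nat.lt_add_one_iff, Nat.div_lt_iff_lt_mul (by omega)]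
  have : t ≤ t * d := Nat.le_mul_of_pos_right t hd
  rw [add_mul, one_mul]
  omega

/-! ### Ville's inequality and the method of mixtures. -/

section MixtureMartingale

open Filter Topology
open scoped ENNReal

/-- A function whose integral over every set of a sub-`σ`-field is at most the measure of this
set is at most one on average, against every nonnegative weight measurable in the sub-`σ`-field. -/
lemma lintegral_mul_le_of_forall_setLIntegral_le {Ω : Type*} {m m0 : MeasurableSpace Ω}
    (hm : m ≤ m0) {μ : Measure Ω} [IsFiniteMeasure μ] {h : Ω → ℝ≥0∞} (hh : Measurable h)
    (H : ∀ A, MeasurableSet[m] A → ∫⁻ ω in A, h ω ∂μ ≤ μ A)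
    {g : Ω → ℝ≥0∞} (hg : Measurable[m] g) :
    ∫⁻ ω, g ω * h ω ∂μ ≤ ∫⁻ ω, g ω ∂μ := by
  have hg0 : Measurable g := hg.mono hm le_rfl
  have hle : (μ.withDensity h).trim hm ≤ μ.trim hm := by
    refine Measure.le_iff.2 fun A hA => ?_
    rw [trim_measurableSet_eq hm hA, trim_measurableSet_eq hm hA, withDensity_apply _ (hm _ hA)]
    exact H A hA
  calc ∫⁻ ω, g ω * h ω ∂μ = ∫⁻ ω, g ω ∂(μ.withDensity h) := by
        rw [lintegral_withDensity_eq_lintegral_mul _ hh hg0]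
        simp [mul_comm]
    _ = ∫⁻ ω, g ω ∂((μ.withDensity h).trim hm) := (lintegral_trim hm hg).symm
    _ ≤ ∫⁻ ω, g ω ∂(μ.trim hm) := lintegral_mono' hle le_rfl
    _ = ∫⁻ ω, g ω ∂μ := lintegral_trim hm hg

/-- `η` is conditionally `1`-sub-Gaussian given `m`, in integrated form. -/
def CondSubGaussian {Ω : Type*} (m : MeasurableSpace Ω) {m0 : MeasurableSpace Ω} (μ : Measure Ω)
    (η : Ω → ℝ) : Prop :=
  ∀ (v : ℝ) (g : Ω → ℝ≥0∞), Measurable[m] g →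
    ∫⁻ ω, g ω * ENNReal.ofReal (Real.exp (v * η ω - v ^ 2 / 2)) ∂μ ≤ ∫⁻ ω, g ω ∂μ

lemma exists_measurable_finite_range_tendsto {Ω : Type*} [MeasurableSpace Ω] {l : Ω → ℝ}
    (hl : Measurable l) : ∃ A : ℕ → Ω → ℝ, (∀ n, Measurable (A n)) ∧
      (∀ n, (Set.range (A n)).Finite) ∧ ∀ ω, Tendsto (fun n => A n ω) atTop (𝓝 (l ω)) :=
  ⟨fun n => hl.stronglyMeasurable.approx n, fun n => (hl.stronglyMeasurable.approx n).measurable,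
    fun n => (hl.stronglyMeasurable.approx n).finite_range, hl.stronglyMeasurable.tendsto_approx⟩

/-- The constant `v` may be replaced by a predictable `l`, as is needed for `l = ⟨θ - θ₀, x_n⟩`. For
`l` of finite range, split over its fibres and absorb their indicators into `g`; the general case
follows by approximation and Fatou's lemma. -/
lemma CondSubGaussian.lintegral_le {Ω : Type*} {m m0 : MeasurableSpace Ω} (hm : m ≤ m0)
    {μ : Measure Ω} {η : Ω → ℝ} (hη : Measurable η) (H : CondSubGaussian m μ η)
    {l : Ω → ℝ} (hl : Measurable[m] l) {g : Ω → ℝ≥0∞} (hg : Measurable[m] g) :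
    ∫⁻ ω, g ω * ENNReal.ofReal (Real.exp (l ω * η ω - l ω ^ 2 / 2)) ∂μ ≤ ∫⁻ ω, g ω ∂μ := by
  have hg0 : Measurable g := hg.mono hm le_rfl
  obtain ⟨f, hf, hfin, hfl⟩ := @exists_measurable_finite_range_tendsto Ω m l hl
  have hf0 : ∀ n, Measurable (f n) := fun n => (hf n).mono hm le_rfl
  have hsimple : ∀ n,
      ∫⁻ ω, g ω * ENNReal.ofReal (Real.exp (f n ω * η ω - f n ω ^ 2 / 2)) ∂μ ≤
        ∫⁻ ω, g ω ∂μ := by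
    intro n
    have hfib : ∀ v, MeasurableSet[m] (f n ⁻¹' {v}) := fun v => hf n (measurableSet_singleton v)
    have hsum : ∀ F : Ω → ℝ≥0∞, Measurable F →
        ∫⁻ ω, F ω ∂μ = ∑ v ∈ (hfin n).toFinset, ∫⁻ ω, (f n ⁻¹' {v}).indicator F ω ∂μ := by
      intro F hF
      rw [← lintegral_finsetSum _ fun v _ => hF.indicator (hm _ (hfib v))]
      refine lintegral_congr fun ω => ?_
      rw [Finset.sum_eq_single (f n ω)]
      · simp
      · intro v _ hv
        exact Set.indicator_of_notMem (by simpa using hv.symm) _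
      · intro h
        exact absurd (by simp) h
    have hmeas : Measurable fun ω =>
        g ω * ENNReal.ofReal (Real.exp (f n ω * η ω - f n ω ^ 2 / 2)) := by
      have := hf0 n
      fun_prop
    rw [hsum _ hmeas, hsum g hg0]
    refine Finset.sum_le_sum fun v _ => ?_
    refine le_trans (le_of_eq ?_) (H v _ (hg.indicator (hfib v)))
    refine lintegral_congr fun ω => ?_
    by_cases hω : f n ω = v
    · simp [Set.indicator, hω]
    · simp [Set.indicator, hω]
  have hlim : ∀ ω, Tendsto
      (fun n => g ω * ENNReal.ofReal (Real.exp (f n ω * η ω - f n ω ^ 2 / 2)))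
      atTop (𝓝 (g ω * ENNReal.ofReal (Real.exp (l ω * η ω - l ω ^ 2 / 2)))) := by
    intro ω
    have h1 := hfl ω
    refine ENNReal.Tendsto.const_mul ?_ (Or.inl ?_)
    · refine ENNReal.tendsto_ofReal ?_
      have hc : Continuous fun y : ℝ => Real.exp (y * η ω - y ^ 2 / 2) := by fun_prop
      exact (hc.tendsto _).comp h1
    · simp [Real.exp_pos]
  calc ∫⁻ ω, g ω * ENNReal.ofReal (Real.exp (l ω * η ω - l ω ^ 2 / 2)) ∂μ
      = ∫⁻ ω, liminf (fun n => g ω * ENNReal.ofReal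
          (Real.exp (f n ω * η ω - f n ω ^ 2 / 2))) atTop ∂μ :=
        lintegral_congr fun ω => (hlim ω).liminf_eq.symm
    _ ≤ liminf (fun n => ∫⁻ ω, g ω * ENNReal.ofReal
          (Real.exp (f n ω * η ω - f n ω ^ 2 / 2)) ∂μ) atTop := by
        refine lintegral_liminf_le fun n => ?_
        have := hf0 n
        fun_prop
    _ ≤ ∫⁻ ω, g ω ∂μ :=
        (liminf_le_liminf (Eventually.of_forall fun n => hsimple n)).trans
          (by simp)

/-- Ville's inequality for a nonnegative supermartingale, over a finite horizon. -/
lemma mul_measure_exists_le_of_setLIntegral_antitone {Ω : Type*} [MeasurableSpace Ω]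
    {μ : Measure Ω} {G : ℕ → MeasurableSpace Ω} (hG : Monotone G)
    (hG0 : ∀ n, G n ≤ ‹MeasurableSpace Ω›) {W : ℕ → Ω → ℝ≥0∞}
    (hW : ∀ n, Measurable[G n] (W n))
    (hstep : ∀ n A, MeasurableSet[G n] A → ∫⁻ ω in A, W (n + 1) ω ∂μ ≤ ∫⁻ ω in A, W n ω ∂μ)
    (a : ℝ≥0∞) (N : ℕ) :
    a * μ {ω | ∃ n ≤ N, a ≤ W n ω} ≤ ∫⁻ ω, W 0 ω ∂μ := by
  set E : ℕ → Set Ω := fun N => {ω | ∃ n ≤ N, a ≤ W n ω} with hE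
  have hEm : ∀ n, MeasurableSet[G n] (E n) := by
    intro n
    have : E n = ⋃ k ∈ Set.Iic n, {ω | a ≤ W k ω} := by ext ω; simp [hE]
    rw [this]
    exact MeasurableSet.biUnion (Set.to_countable _) fun k hk =>
      hG hk _ (measurableSet_le measurable_const (hW k))
  have hEs : ∀ n, E (n + 1) = E n ∪ ((E n)ᶜ ∩ {ω | a ≤ W (n + 1) ω}) := by
    intro n
    ext ω
    simp only [hE, Set.mem_ofPred_eq, Set.mem_union, Set.mem_inter_iff, Set.mem_compl_iff]
    constructor
    · rintro ⟨k, hk, h⟩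
      by_cases hex : ∃ j ≤ n, a ≤ W j ω
      · exact Or.inl hex
      · refine Or.inr ⟨hex, ?_⟩
        rcases Nat.lt_or_ge k (n + 1) with h' | h'
        · exact absurd ⟨k, by omega, h⟩ hex
        · rwa [show n + 1 = k by omega]
    · rintro (⟨k, hk, h⟩ | ⟨_, h⟩)
      · exact ⟨k, by omega, h⟩
      · exact ⟨n + 1, le_rfl, h⟩
  -- The left side does not increase with `n`: where `a` is first crossed, `W (n + 1)` is at least
  -- `a` and pays for the new measure; elsewhere `hstep` applies, since `(E n)ᶜ` is in `G n`. This
  -- replaces a stopping time.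
  have key : ∀ n, ∫⁻ ω in (E n)ᶜ, W n ω ∂μ + a * μ (E n) ≤ ∫⁻ ω, W 0 ω ∂μ := by
    intro n
    induction n with
    | zero =>
      have hm0 : MeasurableSet (E 0) := hG0 0 _ (hEm 0)
      rw [← lintegral_add_compl (μ := μ) (W 0) hm0, add_comm]
      refine add_le_add_left ?_ _
      calc a * μ (E 0) = ∫⁻ _ in E 0, a ∂μ := by simp
        _ ≤ ∫⁻ ω in E 0, W 0 ω ∂μ := by
          refine setLIntegral_mono' hm0 fun ω hω => ?_
          obtain ⟨k, hk, h⟩ := hω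
          rwa [Nat.le_zero.1 hk] at h
    | succ n ih =>
      have hmn : MeasurableSet (E n) := hG0 n _ (hEm n)
      have hms : MeasurableSet {ω | a ≤ W (n + 1) ω} :=
        hG0 (n + 1) _ (measurableSet_le measurable_const (hW (n + 1)))
      set S : Set Ω := {ω | a ≤ W (n + 1) ω} with hS
      have h1 : (E (n + 1))ᶜ = (E n)ᶜ \ S := by
        rw [hEs]
        ext ω
        simp only [Set.mem_compl_iff, Set.mem_union, Set.mem_inter_iff, Set.mem_sdiff]
        tauto
      have h2 : μ (E (n + 1)) ≤ μ (E n) + μ ((E n)ᶜ ∩ S) := by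
        rw [hEs]; exact measure_union_le _ _
      have h3 : a * μ ((E n)ᶜ ∩ S) ≤ ∫⁻ ω in (E n)ᶜ ∩ S, W (n + 1) ω ∂μ := by
        calc a * μ ((E n)ᶜ ∩ S) = ∫⁻ _ in (E n)ᶜ ∩ S, a ∂μ := by simp
          _ ≤ _ := setLIntegral_mono' (hmn.compl.inter hms) fun ω hω => hω.2
      calc ∫⁻ ω in (E (n + 1))ᶜ, W (n + 1) ω ∂μ + a * μ (E (n + 1))
          ≤ ∫⁻ ω in (E n)ᶜ \ S, W (n + 1) ω ∂μ + a * (μ (E n) + μ ((E n)ᶜ ∩ S)) := by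
            rw [h1]; gcongr
        _ ≤ ∫⁻ ω in (E n)ᶜ \ S, W (n + 1) ω ∂μ +
              (a * μ (E n) + ∫⁻ ω in (E n)ᶜ ∩ S, W (n + 1) ω ∂μ) := by
            rw [mul_add]; gcongr
        _ = (∫⁻ ω in (E n)ᶜ ∩ S, W (n + 1) ω ∂μ + ∫⁻ ω in (E n)ᶜ \ S, W (n + 1) ω ∂μ)
              + a * μ (E n) := by ring
        _ = ∫⁻ ω in (E n)ᶜ, W (n + 1) ω ∂μ + a * μ (E n) := by
            rw [lintegral_inter_add_sdiff _ _ hms]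
        _ ≤ ∫⁻ ω in (E n)ᶜ, W n ω ∂μ + a * μ (E n) := by
            gcongr 1
            exact hstep n _ (hEm n).compl
        _ ≤ _ := ih
  exact le_trans le_add_self (key N)

/-- The likelihood ratio of the parameter `θ` against `θ₀`, from the first `n` observations. -/
noncomputable def likelihoodRatio {E Ω : Type*} [NormedAddCommGroup E] [InnerProductSpace ℝ E]
    (θ₀ : E) (x : ℕ → Ω → E) (η : ℕ → Ω → ℝ) (n : ℕ) (θ : E) (ω : Ω) : ℝ :=
  Real.exp (∑ k ∈ Finset.range n,
    (inner ℝ (θ - θ₀) (x k ω) * η k ω - inner ℝ (θ - θ₀) (x k ω) ^ 2 / 2))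

section

variable {E Ω : Type*} [NormedAddCommGroup E] [InnerProductSpace ℝ E] [FiniteDimensional ℝ E]
  [MeasurableSpace E] [BorelSpace E]

lemma measurable_likelihoodRatio [MeasurableSpace Ω] (θ₀ : E) {x : ℕ → Ω → E} {η : ℕ → Ω → ℝ}
    {n : ℕ} (hx : ∀ k < n, Measurable (x k)) (hη : ∀ k < n, Measurable (η k)) :
    Measurable fun q : E × Ω => likelihoodRatio θ₀ x η n q.1 q.2 := by
  unfold likelihoodRatio
  refine Real.measurable_exp.comp (Finset.measurable_sum _ fun k hk => ?_)
  have h1 := hx k (Finset.mem_range.1 hk)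
  have h2 := hη k (Finset.mem_range.1 hk)
  have h3 : Measurable fun q : E × Ω => inner ℝ (q.1 - θ₀) (x k q.2) :=
    (measurable_fst.sub_const θ₀).inner (h1.comp measurable_snd)
  have h4 : Measurable fun q : E × Ω => η k q.2 := h2.comp measurable_snd
  fun_prop

lemma measurable_likelihoodRatio_right [MeasurableSpace Ω] (θ₀ : E) {x : ℕ → Ω → E}
    {η : ℕ → Ω → ℝ} {n : ℕ} (hx : ∀ k < n, Measurable (x k)) (hη : ∀ k < n, Measurable (η k))
    (θ : E) : Measurable fun ω => ENNReal.ofReal (likelihoodRatio θ₀ x η n θ ω) :=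
  ((measurable_likelihoodRatio θ₀ hx hη).comp measurable_prodMk_left).ennreal_ofReal

lemma measurable_likelihoodRatio_swap [MeasurableSpace Ω] (θ₀ : E) {x : ℕ → Ω → E}
    {η : ℕ → Ω → ℝ} {n : ℕ} (hx : ∀ k < n, Measurable (x k)) (hη : ∀ k < n, Measurable (η k)) :
    Measurable fun q : Ω × E => ENNReal.ofReal (likelihoodRatio θ₀ x η n q.2 q.1) :=
  ((measurable_likelihoodRatio θ₀ hx hη).comp measurable_swap).ennreal_ofReal

lemma measurable_inner_const_left [MeasurableSpace Ω] {x : Ω → E} (hx : Measurable x) (θ : E) :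
    Measurable fun ω => (inner ℝ θ (x ω) : ℝ) :=
  measurable_const.inner hx

lemma measurable_lintegral_likelihoodRatio [MeasurableSpace Ω] (ν : Measure E) [SFinite ν]
    (θ₀ : E) {x : ℕ → Ω → E} {η : ℕ → Ω → ℝ}
    {n : ℕ} (hx : ∀ k < n, Measurable (x k)) (hη : ∀ k < n, Measurable (η k)) :
    Measurable fun ω => ∫⁻ θ, ENNReal.ofReal (likelihoodRatio θ₀ x η n θ ω) ∂ν :=
  ((measurable_likelihoodRatio θ₀ hx hη).ennreal_ofReal).lintegral_prod_left'

/-- The supermartingale step for fixed `θ`: the new factor is `exp (l η - l ^ 2 / 2)` with `l`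
predictable, and the earlier factors times the indicator of `A` serve as the weight. -/
lemma setLIntegral_likelihoodRatio_succ_le {m m0 : MeasurableSpace Ω} (hm : m ≤ m0)
    {μ : Measure Ω} (θ₀ : E) {x : ℕ → Ω → E} {η : ℕ → Ω → ℝ} {n : ℕ}
    (hx : ∀ k ≤ n, Measurable[m] (x k)) (hη : ∀ k < n, Measurable[m] (η k))
    (hηn : Measurable (η n)) (hsub : CondSubGaussian m μ (η n)) {A : Set Ω}
    (hA : MeasurableSet[m] A) (θ : E) :
    ∫⁻ ω in A, ENNReal.ofReal (likelihoodRatio θ₀ x η (n + 1) θ ω) ∂μ ≤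
      ∫⁻ ω in A, ENNReal.ofReal (likelihoodRatio θ₀ x η n θ ω) ∂μ := by
  have hl : Measurable[m] fun ω => (inner ℝ (θ - θ₀) (x n ω) : ℝ) :=
    @measurable_inner_const_left E Ω _ _ _ _ _ m _ (hx n le_rfl) _
  have hM : Measurable[m] fun ω => ENNReal.ofReal (likelihoodRatio θ₀ x η n θ ω) :=
    @measurable_likelihoodRatio_right E Ω _ _ _ _ _ m θ₀ x η n (fun k hk => hx k hk.le) hη θ
  have hmA := hm _ hA
  have := hsub.lintegral_le hm hηn hl (hM.indicator hA)
  rw [← lintegral_indicator hmA, ← lintegral_indicator hmA]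
  refine le_trans (le_of_eq (lintegral_congr fun ω => ?_)) this
  by_cases hω : ω ∈ A
  · simp only [Set.indicator_of_mem hω, likelihoodRatio, Finset.sum_range_succ]
    rw [Real.exp_add, ENNReal.ofReal_mul (Real.exp_pos _).le]
  · simp [Set.indicator_of_notMem hω]

/-- The method of mixtures: the likelihood ratio averaged over the prior `ν` exceeds `a` at some
time with probability at most `1 / a`. -/
theorem mul_measure_exists_le_lintegral_likelihoodRatio {m0 : MeasurableSpace Ω} {μ : Measure Ω}
    [IsProbabilityMeasure μ] {ν : Measure E} [IsProbabilityMeasure ν]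
    {G : ℕ → MeasurableSpace Ω} (hG : Monotone G) (hG0 : ∀ n, G n ≤ m0)
    (θ₀ : E) {x : ℕ → Ω → E} {η : ℕ → Ω → ℝ}
    (hx : ∀ k, Measurable[G k] (x k)) (hη : ∀ k, Measurable[G (k + 1)] (η k))
    (hsub : ∀ k, CondSubGaussian (G k) μ (η k)) (a : ℝ≥0∞) (N : ℕ) :
    a * μ {ω | ∃ n ≤ N, a ≤ ∫⁻ θ, ENNReal.ofReal (likelihoodRatio θ₀ x η n θ ω) ∂ν} ≤ 1 := by
  have hx0 : ∀ k, Measurable (x k) := fun k => (hx k).mono (hG0 k) le_rfl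
  have hη0 : ∀ k, Measurable (η k) := fun k => (hη k).mono (hG0 _) le_rfl
  have hxn : ∀ n, ∀ k < n, Measurable[G n] (x k) := fun n k hk =>
    (hx k).mono (hG hk.le) le_rfl
  have hηn : ∀ n, ∀ k < n, Measurable[G n] (η k) := fun n k hk => (hη k).mono (hG hk) le_rfl
  refine (mul_measure_exists_le_of_setLIntegral_antitone (μ := μ) hG hG0
    (W := fun n ω => ∫⁻ θ, ENNReal.ofReal (likelihoodRatio θ₀ x η n θ ω) ∂ν)
    (fun n => ?_) (fun n A hA => ?_) a N).trans ?_
  · exact @measurable_lintegral_likelihoodRatio E Ω _ _ _ _ _ (G n) ν _ θ₀ x η n (hxn n) (hηn n)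
  -- By Tonelli, averaging over the prior preserves the step inequality proved for each `θ`.
  · have hswap : ∀ n, ∫⁻ ω in A, ∫⁻ θ, ENNReal.ofReal (likelihoodRatio θ₀ x η n θ ω) ∂ν ∂μ =
        ∫⁻ θ, ∫⁻ ω in A, ENNReal.ofReal (likelihoodRatio θ₀ x η n θ ω) ∂μ ∂ν := fun n =>
      lintegral_lintegral_swap
        (f := fun ω θ => ENNReal.ofReal (likelihoodRatio θ₀ x η n θ ω))
        (measurable_likelihoodRatio_swap θ₀ (fun k _ => hx0 k) (fun k _ => hη0 k)).aemeasurable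
    calc _ = _ := hswap (n + 1)
      _ ≤ _ := lintegral_mono fun θ => setLIntegral_likelihoodRatio_succ_le (hG0 n) θ₀
          (fun k hk => (hx k).mono (hG hk) le_rfl) (hηn n) (hη0 n) (hsub n) hA θ
      _ = _ := (hswap n).symm
  · simp [likelihoodRatio]

end

end MixtureMartingale

/-! ### The debiased noise along a residue class. -/

section MixingNoise

open scoped ENNReal

variable {Ω : Type*} {ε : ℕ → Ω → ℝ}

lemma noiseField_mono : Monotone (noiseField ε) := fun _ _ hst =>
  biSup_mono fun _ hk => ⟨hk.1, hk.2.trans hst⟩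

lemma noiseField_zero : noiseField ε 0 = ⊥ := by
  simp [noiseField]

lemma noiseField_le [m0 : MeasurableSpace Ω] (hε : ∀ t, 1 ≤ t → Measurable (ε t)) (t : ℕ) :
    noiseField ε t ≤ m0 :=
  iSup₂_le fun s hs => (hε s hs.1).comap_le

lemma measurable_noiseField {s : ℕ} (hs : 1 ≤ s) : Measurable[noiseField ε s] (ε s) :=
  Measurable.mono (comap_measurable (ε s))
    (le_iSup₂_of_le (f := fun s _ => MeasurableSpace.comap (ε s) inferInstance) s ⟨hs, le_rfl⟩
      le_rfl) le_rfl

variable [m0 : MeasurableSpace Ω] {μ : Measure Ω} {φ : ℕ → ℝ}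

/-- The bias of the noise at time `s`, as predicted `d` rounds before. -/
noncomputable def noiseBias (μ : Measure Ω) (ε : ℕ → Ω → ℝ) (d s : ℕ) : Ω → ℝ :=
  μ[ε s | noiseField ε (s - d)]

lemma measurable_noiseBias (d s : ℕ) :
    Measurable[noiseField ε (s - d)] (noiseBias μ ε d s) :=
  stronglyMeasurable_condExp.measurable

variable [IsProbabilityMeasure μ]

lemma IsMixingSubGaussian.abs_noiseBias_le {σ : ℝ≥0} (h : IsMixingSubGaussian μ σ φ ε) {d s : ℕ}
    (hd : 1 ≤ d) (hs : 1 ≤ s) : ∀ᵐ ω ∂μ, |noiseBias μ ε d s ω| ≤ φ d := by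
  rcases Nat.lt_or_ge d s with hds | hds
  · exact h.cond_mean d s hd hds
  -- For `s ≤ d` truncated subtraction makes the `σ`-field trivial, so the bias is the mean of `ε
  -- s`, which is zero.
  · refine Filter.Eventually.of_forall fun ω => ?_
    rw [noiseBias, Nat.sub_eq_zero_of_le hds, noiseField_zero, condExp_bot, h.centred s hs,
      abs_zero]
    exact h.rate_nonneg d hd

lemma IsMixingSubGaussian.integrable_exp (h : IsMixingSubGaussian μ 1 φ ε) {d s : ℕ}
    (hd : 1 ≤ d) (hs : 1 ≤ s) (v : ℝ) :
    Integrable (fun ω => Real.exp (v * (ε s ω - noiseBias μ ε d s ω))) μ := by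
  have hb : Measurable (noiseBias μ ε d s) :=
    (measurable_noiseBias d s).mono (noiseField_le h.measurable _) le_rfl
  have hε := h.measurable s hs
  refine (((h.subGaussian s hs).integrable_exp_mul v).const_mul
    (Real.exp (|v| * φ d))).mono' ?_ ?_
  · exact Measurable.aestronglyMeasurable (by fun_prop)
  · filter_upwards [h.abs_noiseBias_le hd hs] with ω hω
    rw [Real.norm_eq_abs, abs_of_pos (Real.exp_pos _), ← Real.exp_add, Real.exp_le_exp]
    have h1 : |v * noiseBias μ ε d s ω| ≤ |v| * φ d := by
      rw [abs_mul]; exact mul_le_mul_of_nonneg_left hω (abs_nonneg _)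
    linarith [neg_abs_le (v * noiseBias μ ε d s ω)]

lemma IsMixingSubGaussian.condExp_exp_le (h : IsMixingSubGaussian μ 1 φ ε) {d s : ℕ}
    (hd : 1 ≤ d) (hs : 1 ≤ s) (v : ℝ) :
    ∀ᵐ ω ∂μ, (μ[fun ω' => Real.exp (v * (ε s ω' - noiseBias μ ε d s ω')) |
      noiseField ε (s - d)]) ω ≤ Real.exp (v ^ 2 / 2) := by
  rcases Nat.lt_or_ge d s with hds | hds
  · simpa [noiseBias] using h.cond_subGaussian d s hd hds v
  · refine Filter.Eventually.of_forall fun ω => ?_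
    have h0 : ∀ ω, noiseBias μ ε d s ω = 0 := fun ω => by
      rw [noiseBias, Nat.sub_eq_zero_of_le hds, noiseField_zero, condExp_bot, h.centred s hs]
    simp only [h0, sub_zero]
    rw [Nat.sub_eq_zero_of_le hds, noiseField_zero, condExp_bot]
    simpa [mgf] using (h.subGaussian s hs).mgf_le v

/-- It suffices to test on sets `A` of the sub-`σ`-field; there the integral of the exponential
equals that of its conditional expectation, which is at most `exp (v ^ 2 / 2)`. -/
lemma IsMixingSubGaussian.condSubGaussian (h : IsMixingSubGaussian μ 1 φ ε) {d s : ℕ}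
    (hd : 1 ≤ d) (hs : 1 ≤ s) :
    CondSubGaussian (noiseField ε (s - d)) μ (fun ω => ε s ω - noiseBias μ ε d s ω) := by
  intro v g hg
  have hm := noiseField_le h.measurable (s - d)
  have hint := h.integrable_exp hd hs v
  have hb : Measurable (noiseBias μ ε d s) := (measurable_noiseBias d s).mono hm le_rfl
  have hε := h.measurable s hs
  refine lintegral_mul_le_of_forall_setLIntegral_le hm (by fun_prop) (fun A hA => ?_) hg
  have hsplit : ∀ ω, Real.exp (v * (ε s ω - noiseBias μ ε d s ω) - v ^ 2 / 2) =
      Real.exp (-(v ^ 2 / 2)) * Real.exp (v * (ε s ω - noiseBias μ ε d s ω)) := fun ω => by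
    rw [← Real.exp_add]; ring_nf
  simp only [hsplit]
  rw [← ofReal_integral_eq_lintegral_ofReal (hint.integrableOn.const_mul _)
    (Filter.Eventually.of_forall fun ω => by positivity), integral_const_mul,
    ← setIntegral_condExp hm hint hA]
  have hle : ∫ ω in A, (μ[fun ω' => Real.exp (v * (ε s ω' - noiseBias μ ε d s ω')) |
      noiseField ε (s - d)]) ω ∂μ ≤ ∫ _ in A, Real.exp (v ^ 2 / 2) ∂μ :=
    integral_mono_ae integrable_condExp.integrableOn (integrable_const _)
      (ae_restrict_of_ae (h.condExp_exp_le hd hs v))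
  rw [setIntegral_const, smul_eq_mul] at hle
  refine ENNReal.ofReal_le_of_le_toReal ?_
  calc _ ≤ Real.exp (-(v ^ 2 / 2)) * (μ.real A * Real.exp (v ^ 2 / 2)) := by gcongr
    _ = μ.real A * (Real.exp (-(v ^ 2 / 2)) * Real.exp (v ^ 2 / 2)) := by ring
    _ = (μ A).toReal := by rw [← Real.exp_add]; simp [Measure.real]

variable {E : Type*} [NormedAddCommGroup E] [InnerProductSpace ℝ E] [FiniteDimensional ℝ E]
  [MeasurableSpace E] [BorelSpace E]

/-- The mixture of the likelihood ratios over the `i`-th residue class of rounds modulo `d`. -/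
noncomputable def residueMixture (μ : Measure Ω) (ν : Measure E) (θ₀ : E) (X : ℕ → Ω → E)
    (ε : ℕ → Ω → ℝ) (d i n : ℕ) (ω : Ω) : ℝ≥0∞ :=
  ∫⁻ θ, ENNReal.ofReal (likelihoodRatio θ₀ (fun k => X (i + 1 + k * d))
    (fun k ω => ε (i + 1 + k * d) ω - noiseBias μ ε d (i + 1 + k * d) ω) n θ ω) ∂ν

/-- With probability `1 - δ`, the biases are small and all mixtures stay below `d / δ`. -/
theorem IsMixingSubGaussian.measure_residueMixture_lt (h : IsMixingSubGaussian μ 1 φ ε) {d : ℕ}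
    (hd : 1 ≤ d) {δ : ℝ} (hδ : 0 < δ) (ν : Measure E) [IsProbabilityMeasure ν] (θ₀ : E)
    {X : ℕ → Ω → E} (hX : ∀ s, 1 ≤ s → Measurable[noiseField ε (s - d)] (X s)) (N : ℕ) :
    ENNReal.ofReal (1 - δ) ≤ μ {ω | (∀ s, 1 ≤ s → |noiseBias μ ε d s ω| ≤ φ d) ∧
      ∀ i < d, ∀ n ≤ N, residueMixture μ ν θ₀ X ε d i n ω < ENNReal.ofReal (d / δ)} := by
  have hd0 : (0 : ℝ) < d := by exact_mod_cast hd
  set Good : Set Ω := {ω | (∀ s, 1 ≤ s → |noiseBias μ ε d s ω| ≤ φ d) ∧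
      ∀ i < d, ∀ n ≤ N, residueMixture μ ν θ₀ X ε d i n ω < ENNReal.ofReal (d / δ)} with hGood
  set Z : Set Ω := {ω | ¬ ∀ s, 1 ≤ s → |noiseBias μ ε d s ω| ≤ φ d} with hZ
  have hZ0 : μ Z = 0 := by
    have : ∀ᵐ ω ∂μ, ∀ s, 1 ≤ s → |noiseBias μ ε d s ω| ≤ φ d :=
      ae_all_iff.2 fun s => Filter.eventually_imp_distrib_left.2 fun hs => h.abs_noiseBias_le hd hs
    exact this
  set Bad : ℕ → Set Ω := fun i =>
    {ω | ∃ n ≤ N, ENNReal.ofReal (d / δ) ≤ residueMixture μ ν θ₀ X ε d i n ω} with hBad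
  have hBadle : ∀ i, μ (Bad i) ≤ ENNReal.ofReal (δ / d) := by
    intro i
    -- The field seen before step `k + 1` of the class ends exactly at the round of step `k`; hence
    -- the debiased noise of step `k` is adapted to it.
    have hstep : ∀ k, i + 1 + (k + 1) * d - d = i + 1 + k * d := fun k => by
      rw [add_mul, one_mul]; omega
    have key := mul_measure_exists_le_lintegral_likelihoodRatio (μ := μ) (ν := ν)
      (G := fun k => noiseField ε (i + 1 + k * d - d))
      (fun k l hkl => noiseField_mono (by
        have := Nat.mul_le_mul_right d hkl
        omega))
      (fun k => noiseField_le h.measurable _) θ₀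
      (x := fun k => X (i + 1 + k * d))
      (η := fun k ω => ε (i + 1 + k * d) ω - noiseBias μ ε d (i + 1 + k * d) ω)
      (fun k => hX _ (by omega))
      (fun k => by
        rw [hstep]
        exact (measurable_noiseField (by omega)).sub
          ((measurable_noiseBias d _).mono (noiseField_mono (Nat.sub_le _ _)) le_rfl))
      (fun k => h.condSubGaussian hd (by omega)) (ENNReal.ofReal (d / δ)) N
    have hpos : 0 < (d : ℝ) / δ := by positivity
    calc μ (Bad i) ≤ 1 / ENNReal.ofReal (d / δ) := by
          rw [ENNReal.le_div_iff_mul_le (Or.inl (by simpa using hpos)) (Or.inl (by simp)),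
            mul_comm]
          exact key
      _ = ENNReal.ofReal (δ / d) := by
          rw [one_div, ← ENNReal.ofReal_inv_of_pos hpos, inv_div]
  have hcompl : Goodᶜ ⊆ Z ∪ ⋃ i ∈ Finset.range d, Bad i := by
    intro ω hω
    by_cases hz : ω ∈ Z
    · exact Or.inl hz
    · refine Or.inr ?_
      by_contra hbad
      simp only [hBad, Set.mem_iUnion, Set.mem_ofPred_eq, Finset.mem_range, not_exists, not_and,
        not_le] at hbad
      exact hω ⟨not_not.1 hz, hbad⟩
  have hle : μ Goodᶜ ≤ ENNReal.ofReal δ := by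
    calc μ Goodᶜ ≤ μ Z + μ (⋃ i ∈ Finset.range d, Bad i) :=
          (measure_mono hcompl).trans (measure_union_le _ _)
      _ ≤ 0 + ∑ i ∈ Finset.range d, ENNReal.ofReal (δ / d) := by
          rw [hZ0]
          gcongr
          exact (measure_biUnion_finset_le _ _).trans (Finset.sum_le_sum fun i _ => hBadle i)
      _ = ENNReal.ofReal δ := by
          rw [zero_add, Finset.sum_const, Finset.card_range, nsmul_eq_mul,
            ← ENNReal.ofReal_natCast, ← ENNReal.ofReal_mul hd0.le]
          congr 1
          field_simp
  rw [ENNReal.ofReal_sub _ hδ.le, ENNReal.ofReal_one, tsub_le_iff_right]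
  calc (1 : ℝ≥0∞) = μ Set.univ := measure_univ.symm
    _ ≤ μ Good + μ Goodᶜ := by rw [← Set.union_compl_self Good]; exact measure_union_le _ _
    _ ≤ _ := by gcongr

end MixingNoise

/-! ### Lower bound on the mixture. -/

section Laplace

open scoped ENNReal

variable {E : Type*} [NormedAddCommGroup E] [InnerProductSpace ℝ E] [FiniteDimensional ℝ E]
  [MeasurableSpace E] [BorelSpace E]

/-- The uniform distribution on the closed centred ball of radius `R`. -/
noncomputable def uniformBall (E : Type*) [NormedAddCommGroup E] [InnerProductSpace ℝ E]
    [FiniteDimensional ℝ E] [MeasurableSpace E] [BorelSpace E] (R : ℝ) : Measure E :=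
  (volume (Metric.closedBall (0 : E) R))⁻¹ • volume.restrict (Metric.closedBall 0 R)

lemma isProbabilityMeasure_uniformBall {R : ℝ} (hR : 0 < R) :
    IsProbabilityMeasure (uniformBall E R) := by
  refine ⟨?_⟩
  rw [uniformBall, Measure.smul_apply, Measure.restrict_apply_univ, smul_eq_mul]
  exact ENNReal.inv_mul_cancel (Metric.measure_closedBall_pos _ _ hR).ne'
    measure_closedBall_lt_top.ne

/-- The integral over a ball of the exponential of a quadratic function is bounded below by
symmetrisation around the centre. -/
lemma ofReal_mul_volume_le_setLIntegral_exp {f : E → ℝ} (hf : Measurable f) {θ : E} {c b : ℝ}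
    (hsym : ∀ v, ‖v‖ ≤ c → 2 * b ≤ f (θ + v) + f (θ - v)) :
    ENNReal.ofReal (Real.exp b) * volume (Metric.closedBall (0 : E) c) ≤
      ∫⁻ θ' in Metric.closedBall θ c, ENNReal.ofReal (Real.exp (f θ')) := by
  set F : E → ℝ≥0∞ := fun θ' => ENNReal.ofReal (Real.exp (f θ')) with hF
  have hFm : Measurable F := by fun_prop
  have hball : MeasurableSet (Metric.closedBall (0 : E) c) :=
    Metric.isClosed_closedBall.measurableSet
  have hballθ : MeasurableSet (Metric.closedBall θ c) := Metric.isClosed_closedBall.measurableSet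
  have hadd : ∫⁻ v in Metric.closedBall (0 : E) c, F (θ + v) =
      ∫⁻ θ' in Metric.closedBall θ c, F θ' := by
    rw [← lintegral_indicator hball, ← lintegral_indicator hballθ,
      ← lintegral_add_left_eq_self (μ := volume) ((Metric.closedBall θ c).indicator F) θ]
    refine lintegral_congr fun v => ?_
    simp [Set.indicator]
  have hsub : ∫⁻ v in Metric.closedBall (0 : E) c, F (θ - v) =
      ∫⁻ θ' in Metric.closedBall θ c, F θ' := by
    rw [← lintegral_indicator hball, ← lintegral_indicator hballθ,
      ← lintegral_sub_left_eq_self (μ := volume) ((Metric.closedBall θ c).indicator F) θ]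
    refine lintegral_congr fun v => ?_
    simp [Set.indicator]
  have hpt : ∀ v ∈ Metric.closedBall (0 : E) c,
      2 * ENNReal.ofReal (Real.exp b) ≤ F (θ + v) + F (θ - v) := by
    intro v hv
    rw [hF, ← ENNReal.ofReal_add (Real.exp_pos _).le (Real.exp_pos _).le, two_mul,
      ← ENNReal.ofReal_add (Real.exp_pos _).le (Real.exp_pos _).le]
    refine ENNReal.ofReal_le_ofReal ?_
    have h1 := hsym v (by simpa using hv)
    -- Linearising both exponentials at `b` bounds their sum below by `exp b * (2 + f (θ + v) + f (θ
    -- - v) - 2 * b)`.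
    have h2 := Real.add_one_le_exp (f (θ + v) - b)
    have h3 := Real.add_one_le_exp (f (θ - v) - b)
    have h4 : Real.exp (f (θ + v)) = Real.exp b * Real.exp (f (θ + v) - b) := by
      rw [← Real.exp_add]; ring_nf
    have h5 : Real.exp (f (θ - v)) = Real.exp b * Real.exp (f (θ - v) - b) := by
      rw [← Real.exp_add]; ring_nf
    rw [h4, h5]
    nlinarith [Real.exp_pos b]
  have h2 : 2 * (ENNReal.ofReal (Real.exp b) * volume (Metric.closedBall (0 : E) c)) ≤
      2 * ∫⁻ θ' in Metric.closedBall θ c, F θ' := by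
    calc 2 * (ENNReal.ofReal (Real.exp b) * volume (Metric.closedBall (0 : E) c))
        = ∫⁻ _ in Metric.closedBall (0 : E) c, 2 * ENNReal.ofReal (Real.exp b) := by
          rw [setLIntegral_const, mul_assoc]
      _ ≤ ∫⁻ v in Metric.closedBall (0 : E) c, (F (θ + v) + F (θ - v)) :=
          setLIntegral_mono' hball hpt
      _ = 2 * ∫⁻ θ' in Metric.closedBall θ c, F θ' := by
          rw [lintegral_add_left (by fun_prop), hadd, hsub, two_mul]
  exact (ENNReal.mul_le_mul_iff_right (by simp) (by simp)).1 h2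

/-- The prior has radius `B + 1` so that it contains every ball of radius `c ≤ 1` about a point of
the ball of radius `B`. The power of `c / (B + 1)` is the prior mass of such a ball. -/
lemma ofReal_le_lintegral_uniformBall_exp {f : E → ℝ} (hf : Measurable f) {θ : E} {B c b : ℝ}
    (hB : 0 < B) (hθ : θ ∈ Metric.closedBall 0 B) (hc : 0 < c) (hc1 : c ≤ 1)
    (hsym : ∀ v, ‖v‖ ≤ c → 2 * b ≤ f (θ + v) + f (θ - v)) :
    ENNReal.ofReal ((c / (B + 1)) ^ Module.finrank ℝ E * Real.exp b) ≤
      ∫⁻ θ', ENNReal.ofReal (Real.exp (f θ')) ∂(uniformBall E (B + 1)) := by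
  have hB1 : 0 < B + 1 := by linarith
  set V := volume (Metric.closedBall (0 : E) (B + 1)) with hV
  have hV0 : V ≠ 0 := (Metric.measure_closedBall_pos _ _ hB1).ne'
  have hVt : V ≠ ∞ := measure_closedBall_lt_top.ne
  have hvol : volume (Metric.closedBall (0 : E) c) =
      ENNReal.ofReal ((c / (B + 1)) ^ Module.finrank ℝ E) * V := by
    rw [hV, Measure.addHaar_closedBall _ _ hc.le, Measure.addHaar_closedBall _ _ hB1.le,
      ← mul_assoc, ← ENNReal.ofReal_mul (by positivity), ← mul_pow, div_mul_cancel₀ _ hB1.ne']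
  have hsubset : Metric.closedBall θ c ⊆ Metric.closedBall 0 (B + 1) := by
    refine Metric.closedBall_subset_closedBall' ?_
    rw [Metric.mem_closedBall] at hθ
    linarith
  rw [uniformBall, lintegral_smul_measure, smul_eq_mul, ← hV]
  calc ENNReal.ofReal ((c / (B + 1)) ^ Module.finrank ℝ E * Real.exp b)
      = V⁻¹ * (ENNReal.ofReal (Real.exp b) * volume (Metric.closedBall (0 : E) c)) := by
        rw [hvol, ENNReal.ofReal_mul (by positivity), mul_left_comm, mul_comm _ V, ← mul_assoc V⁻¹,
          ENNReal.inv_mul_cancel hV0 hVt, one_mul, mul_comm]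
    _ ≤ V⁻¹ * ∫⁻ θ' in Metric.closedBall θ c, ENNReal.ofReal (Real.exp (f θ')) := by
        gcongr
        exact ofReal_mul_volume_le_setLIntegral_exp hf hsym
    _ ≤ _ := by
        gcongr

/-- The log-likelihood ratio is quadratic in `θ`, so symmetrising about `θ` cancels its linear part
and costs at most `n c ^ 2 / 2`. As `ω` is fixed, `θ` may depend on the data. -/
lemma sum_le_of_lintegral_likelihoodRatio_lt {Ω : Type*} {θ₀ θ : E} {x : ℕ → Ω → E}
    {η : ℕ → Ω → ℝ} {n : ℕ} {ω : Ω} (hx : ∀ k < n, ‖x k ω‖ ≤ 1) {B c a : ℝ} (ha : 0 < a)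
    (hB : 0 < B) (hθ : θ ∈ Metric.closedBall 0 B) (hc : 0 < c) (hc1 : c ≤ 1)
    (hlt : ∫⁻ θ', ENNReal.ofReal (likelihoodRatio θ₀ x η n θ' ω) ∂(uniformBall E (B + 1)) <
      ENNReal.ofReal a) :
    ∑ k ∈ Finset.range n,
      (inner ℝ (θ - θ₀) (x k ω) * η k ω - inner ℝ (θ - θ₀) (x k ω) ^ 2 / 2) ≤
      Real.log a + Module.finrank ℝ E * Real.log ((B + 1) / c) + n * c ^ 2 / 2 := by
  set f : E → ℝ := fun θ' => ∑ k ∈ Finset.range n,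
    (inner ℝ (θ' - θ₀) (x k ω) * η k ω - inner ℝ (θ' - θ₀) (x k ω) ^ 2 / 2) with hf
  have hfm : Measurable f := by
    have : Continuous f := by fun_prop
    exact this.measurable
  have hB1 : 0 < B + 1 := by linarith
  have hsym : ∀ v, ‖v‖ ≤ c → 2 * (f θ - n * c ^ 2 / 2) ≤ f (θ + v) + f (θ - v) := by
    intro v hv
    have hexp : f (θ + v) + f (θ - v) =
        2 * f θ - ∑ k ∈ Finset.range n, inner ℝ v (x k ω) ^ 2 := by
      simp only [hf]
      rw [← Finset.sum_add_distrib, Finset.mul_sum, ← Finset.sum_sub_distrib]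
      refine Finset.sum_congr rfl fun k _ => ?_
      have h1 : θ + v - θ₀ = (θ - θ₀) + v := by abel
      have h2 : θ - v - θ₀ = (θ - θ₀) - v := by abel
      rw [h1, h2, inner_add_left, inner_sub_left (θ - θ₀) v]
      ring
    have hsum : ∑ k ∈ Finset.range n, inner ℝ v (x k ω) ^ 2 ≤ n * c ^ 2 := by
      calc ∑ k ∈ Finset.range n, inner ℝ v (x k ω) ^ 2 ≤ ∑ _k ∈ Finset.range n, c ^ 2 := by
            refine Finset.sum_le_sum fun k hk => ?_
            rw [← sq_abs]
            refine pow_le_pow_left₀ (abs_nonneg _) ?_ 2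
            calc |inner ℝ v (x k ω)| ≤ ‖v‖ * ‖x k ω‖ := abs_real_inner_le_norm _ _
              _ ≤ c * 1 := mul_le_mul hv (hx k (Finset.mem_range.1 hk)) (norm_nonneg _) hc.le
              _ = c := mul_one c
        _ = n * c ^ 2 := by simp
    rw [hexp]
    linarith
  have h1 := (ofReal_le_lintegral_uniformBall_exp hfm hB hθ hc hc1 hsym).trans_lt hlt
  rw [ENNReal.ofReal_lt_ofReal_iff ha] at h1
  have h2 := Real.log_le_log (by positivity) h1.le
  rw [Real.log_mul (by positivity) (Real.exp_pos _).ne', Real.log_exp, Real.log_pow] at h2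
  have h3 : Real.log ((B + 1) / c) = - Real.log (c / (B + 1)) := by
    rw [← Real.log_inv, inv_div]
  rw [h3]
  linarith

end Laplace

/-! ### Validity of the confidence sets. -/

section Coverage

variable {p : ℕ} {x : ℕ → EuclideanSpace ℝ (Fin p)}

/-- The first-order optimality condition for the least-squares estimator over a ball. -/
lemma IsLeastSquares.sum_sq_le {B : ℝ} {θstar θhat : EuclideanSpace ℝ (Fin p)} {e : ℕ → ℝ} {t : ℕ}
    (h : IsLeastSquares B x (fun s => inner ℝ θstar (x s) + e s) t θhat)
    (hθ : θstar ∈ Metric.closedBall 0 B) :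
    ∑ s ∈ Finset.Icc 1 t, inner ℝ (θhat - θstar) (x s) ^ 2 ≤
      ∑ s ∈ Finset.Icc 1 t, inner ℝ (θhat - θstar) (x s) * e s := by
  set D := ∑ s ∈ Finset.Icc 1 t, inner ℝ (θhat - θstar) (x s) ^ 2 with hD
  set S := ∑ s ∈ Finset.Icc 1 t, inner ℝ (θhat - θstar) (x s) * e s with hS
  have hD0 : 0 ≤ D := Finset.sum_nonneg fun s _ => sq_nonneg _
  have hN : ∀ a : ℝ, ∑ s ∈ Finset.Icc 1 t,
      (inner ℝ (θhat + a • (θstar - θhat)) (x s) - (inner ℝ θstar (x s) + e s)) ^ 2 =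
      (1 - a) ^ 2 * D - 2 * (1 - a) * S + ∑ s ∈ Finset.Icc 1 t, e s ^ 2 := by
    intro a
    rw [hD, hS, Finset.mul_sum, Finset.mul_sum, ← Finset.sum_sub_distrib,
      ← Finset.sum_add_distrib]
    refine Finset.sum_congr rfl fun s _ => ?_
    rw [inner_add_left, inner_smul_left, inner_sub_left, inner_sub_left]
    simp only [conj_trivial]
    ring
  -- Convexity keeps the segment from `θhat` to `θstar` in the ball; comparing the losses at `0` and
  -- `a` and dividing by `a` gives the bound.
  have hmin : ∀ a : ℝ, 0 < a → a ≤ 1 → (2 - a) * D ≤ 2 * S := by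
    intro a ha ha1
    have hmem : θhat + a • (θstar - θhat) ∈ Metric.closedBall (0 : EuclideanSpace ℝ (Fin p)) B :=
      (convex_closedBall _ _).add_smul_sub_mem h.1 hθ ⟨ha.le, ha1⟩
    have h1 := h.2 hmem
    simp only [Set.mem_ofPred_eq] at h1
    have h0 := hN 0
    rw [zero_smul, add_zero] at h0
    rw [hN a, h0] at h1
    nlinarith
  by_contra hlt
  push Not at hlt
  rcases hD0.eq_or_lt with h0 | hpos
  · have := hmin 1 one_pos le_rfl
    linarith
  -- With this `a`, `(2 - a) * D ≥ D + S > 2 * S`.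
  · have ha : 0 < min 1 ((D - S) / D) := lt_min one_pos (div_pos (by linarith) hpos)
    have h1 := hmin _ ha (min_le_left _ _)
    have h2 : min 1 ((D - S) / D) * D ≤ D - S := by
      calc min 1 ((D - S) / D) * D ≤ (D - S) / D * D :=
            mul_le_mul_of_nonneg_right (min_le_right _ _) hpos.le
        _ = D - S := div_mul_cancel₀ _ hpos.ne'
    linarith

/-- The true parameter belongs to the confidence set as soon as the likelihood ratio against the
least-squares estimator is controlled, and the bias of the noise is small. -/
theorem mem_confidenceSet_of_sum_le {B δ L : ℝ} {φ : ℕ → ℝ} {d t : ℕ} {e b : ℕ → ℝ}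
    {θstar θhat : EuclideanSpace ℝ (Fin p)} (hp : 1 ≤ p) (hd : 1 ≤ d) (hB : 0 < B)
    (hL : 0 ≤ L) (hx : ∀ s ∈ Finset.Icc 1 t, ‖x s‖ ≤ 1)
    (hθ : θstar ∈ Metric.closedBall 0 B)
    (hls : IsLeastSquares B x (fun s => inner ℝ θstar (x s) + e s) t θhat)
    (hb : ∀ s ∈ Finset.Icc 1 t, |b s| ≤ φ d) (hφ0 : 0 ≤ φ d)
    (hmix : ∀ c : ℝ, 0 < c → c ≤ 1 → ∑ s ∈ Finset.Icc 1 t,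
      (inner ℝ (θhat - θstar) (x s) * (e s - b s) - inner ℝ (θhat - θstar) (x s) ^ 2 / 2) ≤
        d * Real.log (d / δ) + d * (p * Real.log ((B + 1) / c)) + t * c ^ 2 / 2)
    (hR : (d : ℝ) * p / 2 *
          Real.log ((B + 1) ^ 2 * Real.exp 1 * max ((d : ℝ) * p) ((t : ℝ) + d) / ((d : ℝ) * p))
        + d * Real.log (d / δ) ≤ 2 * d * p * L)
    (hφ : φ d ≤ (B + 1) / 4) (hφL : 32 * B * L * φ d * (1 + 8 * p * L) ≤ 1) :
    θstar ∈ confidenceSet B (1 / B ^ 2) δ φ d x t θhat := by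
  have hd0 : (1 : ℝ) ≤ d := by exact_mod_cast hd
  have hp0 : (1 : ℝ) ≤ p := by exact_mod_cast hp
  have ht0 : (0 : ℝ) ≤ t := Nat.cast_nonneg t
  have hdp : (0 : ℝ) < d * p := by positivity
  have hB1 : 0 < B + 1 := by linarith
  set m : ℝ := max ((d : ℝ) * p) ((t : ℝ) + d) with hm
  have hm0 : 0 < m := lt_max_of_lt_left hdp
  -- This `c` produces the logarithm of the radius. As `m ≥ t + d` and not just `t`, `t * c ^ 2`
  -- falls short of `d * p` by at least `d * p * (d / (t + d))`, a slack used below.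
  set c : ℝ := √(d * p / m) with hc
  have hc0 : 0 < c := Real.sqrt_pos.2 (by positivity)
  have hcsq : c ^ 2 = d * p / m := Real.sq_sqrt (by positivity)
  have hc1 : c ≤ 1 := by
    rw [hc, Real.sqrt_le_one]
    exact (div_le_one hm0).2 (le_max_left _ _)
  have htc : t * c ^ 2 ≤ d * p * (t / (t + d)) := by
    rw [hcsq]
    have : d * p / m ≤ d * p / (t + d) :=
      div_le_div_of_nonneg_left hdp.le (by linarith) (le_max_right _ _)
    calc t * (d * p / m) ≤ t * (d * p / (t + d)) := by gcongr
      _ = _ := by ring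
  set Λ := Real.log ((B + 1) ^ 2 * Real.exp 1 * m / (d * p)) with hΛ
  have hlog : 2 * Real.log ((B + 1) / c) = Λ - 1 := by
    have h1 : (B + 1) ^ 2 * Real.exp 1 * m / (d * p) = ((B + 1) / c) ^ 2 * Real.exp 1 := by
      rw [div_pow, hcsq]; field_simp
    rw [hΛ, h1, Real.log_mul (by positivity) (Real.exp_pos _).ne', Real.log_pow, Real.log_exp]
    push_cast
    ring
  set u : ℕ → ℝ := fun s => inner ℝ (θhat - θstar) (x s) with hu
  set D := ∑ s ∈ Finset.Icc 1 t, u s ^ 2 with hD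
  have hD0 : 0 ≤ D := Finset.sum_nonneg fun s _ => sq_nonneg _
  set U := ∑ s ∈ Finset.Icc 1 t, |u s| with hU
  have hU0 : 0 ≤ U := Finset.sum_nonneg fun s _ => abs_nonneg _
  set R := d * Real.log (d / δ) + d * p / 2 * (Λ - 1) + t * c ^ 2 / 2 with hRdef
  have hmain : D / 2 ≤ R + φ d * U := by
    have h1 := hmix c hc0 hc1
    have h2 : D ≤ ∑ s ∈ Finset.Icc 1 t, u s * e s := hls.sum_sq_le hθ
    have h3 : ∑ s ∈ Finset.Icc 1 t, (u s * (e s - b s) - u s ^ 2 / 2) =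
        ∑ s ∈ Finset.Icc 1 t, u s * e s - ∑ s ∈ Finset.Icc 1 t, u s * b s - D / 2 := by
      rw [hD, Finset.sum_div, ← Finset.sum_sub_distrib, ← Finset.sum_sub_distrib]
      exact Finset.sum_congr rfl fun s _ => by ring
    have h4 : ∑ s ∈ Finset.Icc 1 t, u s * b s ≤ φ d * U := by
      rw [hU, Finset.mul_sum]
      refine Finset.sum_le_sum fun s hs => ?_
      calc u s * b s ≤ |u s * b s| := le_abs_self _
        _ = |b s| * |u s| := by rw [abs_mul, mul_comm]
        _ ≤ φ d * |u s| := mul_le_mul_of_nonneg_right (hb s hs) (abs_nonneg _)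
    have h5 : d * (p * Real.log ((B + 1) / c)) = d * p / 2 * (Λ - 1) := by
      rw [← hlog]; ring
    rw [h3, h5] at h1
    linarith
  have hCS : U ^ 2 ≤ t * D := by
    have := sq_sum_le_card_mul_sum_sq (s := Finset.Icc 1 t) (f := fun s => |u s|)
    simpa [hU, hD, sq_abs] using this
  have hUB : U ≤ 2 * B * t := by
    calc U ≤ ∑ _s ∈ Finset.Icc 1 t, 2 * B := by
          refine Finset.sum_le_sum fun s hs => ?_
          have h1 : ‖θhat‖ ≤ B := by simpa using hls.1
          have h2 : ‖θstar‖ ≤ B := by simpa using hθ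
          calc |u s| ≤ ‖θhat - θstar‖ * ‖x s‖ := abs_real_inner_le_norm _ _
            _ ≤ (B + B) * 1 := mul_le_mul ((norm_sub_le _ _).trans (add_le_add h1 h2)) (hx s hs)
                (norm_nonneg _) (by linarith)
            _ = 2 * B := by ring
      _ = 2 * B * t := by simp [mul_comm]
  have htd : (t : ℝ) / (t + d) ≤ 1 := (div_le_one (by linarith)).2 (by linarith)
  have hRle : R ≤ 2 * d * p * L := by
    have : t * c ^ 2 ≤ d * p := htc.trans (mul_le_of_le_one_right hdp.le htd)
    linarith
  have hfinal : D / 2 ≤ d * p / 2 * Λ + t * φ d * (B + 1) + d * Real.log (d / δ) := by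
    -- For small `D`, Cauchy–Schwarz gives `U ≤ t * (B + 1)`, as the radius allows. For large `D`,
    -- it gives `(B + 1) * U ≤ D`, so the bias term is at most `D / 4` and is absorbed; then `D ≤ 4
    -- * R`, which forces `t ≤ 8 * d * p * L`.
    rcases le_or_gt D (t * (B + 1) ^ 2) with hcase | hcase
    · have hUt : U ≤ t * (B + 1) := by
        refine abs_le_of_sq_le_sq' ?_ (by positivity) |>.2
        calc U ^ 2 ≤ t * (t * (B + 1) ^ 2) := hCS.trans (mul_le_mul_of_nonneg_left hcase ht0)
          _ = _ := by ring
      have h1 : φ d * U ≤ φ d * (t * (B + 1)) := mul_le_mul_of_nonneg_left hUt hφ0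
      have : t * c ^ 2 ≤ d * p := htc.trans (mul_le_of_le_one_right hdp.le htd)
      linarith
    · have hUD : (B + 1) * U ≤ D := by
        refine abs_le_of_sq_le_sq' ?_ hD0 |>.2
        calc ((B + 1) * U) ^ 2 = (B + 1) ^ 2 * U ^ 2 := by ring
          _ ≤ (B + 1) ^ 2 * (t * D) := mul_le_mul_of_nonneg_left hCS (by positivity)
          _ = (t * (B + 1) ^ 2) * D := by ring
          _ ≤ D * D := mul_le_mul_of_nonneg_right hcase.le hD0
          _ = D ^ 2 := by ring
      have h1 : φ d * U ≤ (B + 1) / 4 * U := mul_le_mul_of_nonneg_right hφ hU0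
      have h2 : t * (B + 1) ^ 2 ≤ 8 * d * p * L := by linarith
      have h3 : (t : ℝ) ≤ 8 * d * p * L :=
        (le_mul_of_one_le_right ht0 (one_le_pow₀ (by linarith))).trans h2
      -- For such `t` even the crude `U ≤ 2 * B * t` suffices: `hφL` fits the whole bias term into
      -- the slack left by `c`.
      have h4 : φ d * U ≤ d * p / 2 * (d / (t + d)) := by
        have h5 : 1 / (1 + 8 * p * L) ≤ d / (t + d) := by
          rw [div_le_div_iff₀ (by positivity) (by linarith)]
          linarith
        have h6 : 32 * B * L * φ d ≤ 1 / (1 + 8 * p * L) := by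
          rwa [le_div_iff₀ (by positivity)]
        calc φ d * U ≤ φ d * (2 * B * (8 * d * p * L)) := by
              refine mul_le_mul_of_nonneg_left (hUB.trans ?_) hφ0
              gcongr
          _ = d * p / 2 * (32 * B * L * φ d) := by ring
          _ ≤ _ := by
              refine mul_le_mul_of_nonneg_left (h6.trans h5) (by positivity)
      have h7 : (d : ℝ) / (t + d) = 1 - t / (t + d) := by
        have : (t : ℝ) + d ≠ 0 := by linarith
        field_simp
        ring
      have h8 : 0 ≤ t * φ d * (B + 1) := by positivity
      rw [h7] at h4
      linarith
  refine ⟨hθ, ?_⟩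
  have hsymm : ∀ s, inner ℝ (θstar - θhat) (x s) ^ 2 = u s ^ 2 := fun s => by
    rw [hu]
    simp only
    rw [← neg_sub θhat θstar, inner_neg_left, neg_sq]
  have hnorm : ‖θstar - θhat‖ ^ 2 ≤ 4 * B ^ 2 := by
    have h1 : ‖θhat‖ ≤ B := by simpa using hls.1
    have h2 : ‖θstar‖ ≤ B := by simpa using hθ
    have h3 := norm_sub_le θstar θhat
    have h4 : ‖θstar - θhat‖ ^ 2 ≤ (2 * B) ^ 2 := pow_le_pow_left₀ (norm_nonneg _) (by linarith) 2
    linarith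
  rw [weightedNormSq_featureCov, Finset.sum_congr rfl fun s _ => hsymm s]
  have : 1 / B ^ 2 * ‖θstar - θhat‖ ^ 2 ≤ 1 / B ^ 2 * (4 * B ^ 2) := by gcongr
  linarith

end Coverage

/-! ### Regret on the event of valid confidence sets. -/

section Regret

variable {p : ℕ} {B lam : ℝ} {x : ℕ → EuclideanSpace ℝ (Fin p)}

lemma weightedNormSq_sub_le {A : Matrix (Fin p) (Fin p) ℝ} (hA : A.PosDef)
    (u w : EuclideanSpace ℝ (Fin p)) :
    weightedNormSq A (u - w) ≤ 2 * weightedNormSq A u + 2 * weightedNormSq A w := by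
  have h1 := weightedNormSq_sub_smul hA.isHermitian u w 1
  have h2 := weightedNormSq_sub_smul hA.isHermitian u w (-1)
  have h3 := weightedNormSq_nonneg hA (u - (-1 : ℝ) • w)
  rw [one_smul] at h1
  linarith

/-- The features played in the `i`-th residue class modulo `d`. -/
def residueSeq {E : Type*} (x : ℕ → E) (d i : ℕ) (k : ℕ) : E := x (i + 1 + (k - 1) * d)

/-- The first `k` rounds of class `i` are among the rounds up to `i + 1 + k * d - d`, and dropping
the others only shrinks the form. The smaller matrix gains one arm at each step of its class, as the
elliptical potential lemma requires. -/
lemma weightedNormSq_residueSeq_le {d i : ℕ} (hd : 1 ≤ d) (hi : i < d) (k : ℕ)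
    (u : EuclideanSpace ℝ (Fin p)) :
    weightedNormSq (featureCov lam (residueSeq x d i) k) u ≤
      weightedNormSq (featureCov lam x (i + 1 + k * d - d)) u := by
  rcases Nat.eq_zero_or_pos k with rfl | hk
  · rw [weightedNormSq_featureCov, weightedNormSq_featureCov]
    have : 0 ≤ ∑ s ∈ Finset.Icc 1 (i + 1 + 0 * d - d), inner ℝ u (x s) ^ 2 :=
      Finset.sum_nonneg fun s _ => sq_nonneg _
    simpa using this
  · rw [weightedNormSq_featureCov, weightedNormSq_featureCov,
      sum_Icc_eq_sum_residues hd (i + 1 + k * d - d)]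
    refine add_le_add ?_ le_rfl
    have hcount : (i + 1 + k * d - d + d - 1 - i) / d = k := by
      have : d ≤ k * d := Nat.le_mul_of_pos_left d hk
      have h1 : i + 1 + k * d - d + d - 1 - i = k * d := by omega
      rw [h1, Nat.mul_div_cancel _ (by omega)]
    have hle := Finset.single_le_sum (s := Finset.range d) (a := i)
      (f := fun i' => ∑ j ∈ Finset.range ((i + 1 + k * d - d + d - 1 - i') / d),
        inner ℝ u (x (i' + 1 + j * d)) ^ 2)
      (fun i' _ => Finset.sum_nonneg fun j _ => sq_nonneg _) (Finset.mem_range.2 hi)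
    refine le_trans (le_of_eq ?_) hle
    simp only [hcount]
    rw [← Finset.Ico_add_one_right_eq_Icc, Finset.sum_Ico_eq_sum_range]
    simp [residueSeq, add_comm]

/-- Two points of a confidence set are at squared weighted distance at most `8 * b`; Cauchy–Schwarz
against the dual norm gives the width. The minimum with `1` comes from `|⟨θ - θ', y⟩| ≤ 2 * B` and
`hBb`. -/
lemma inner_le_add_sqrt_of_mem {d i k : ℕ} {b : ℝ} (hd : 1 ≤ d) (hi : i < d) (hlam : 0 < lam)
    (hB : 0 < B) (hBb : B ^ 2 ≤ 2 * b)
    {θhat θ θ' y : EuclideanSpace ℝ (Fin p)} (hy : ‖y‖ ≤ 1)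
    (hθ : θ ∈ Metric.closedBall 0 B) (hθ' : θ' ∈ Metric.closedBall 0 B)
    (h : 1 / 2 * weightedNormSq (featureCov lam x (i + 1 + k * d - d)) (θ - θhat) ≤ b)
    (h' : 1 / 2 * weightedNormSq (featureCov lam x (i + 1 + k * d - d)) (θ' - θhat) ≤ b) :
    inner ℝ y θ ≤ inner ℝ y θ' + √(8 * b *
      min 1 (weightedNormSq (featureCov lam (residueSeq x d i) k)⁻¹ y)) := by
  set A := featureCov lam (residueSeq x d i) k
  have hA : A.PosDef := featureCov_posDef hlam k
  have hb : 0 ≤ b := by nlinarith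
  have hnorm : weightedNormSq A (θ - θ') ≤ 8 * b := by
    refine (weightedNormSq_residueSeq_le hd hi k _).trans ?_
    have h1 := weightedNormSq_sub_le
      (featureCov_posDef (x := x) hlam (i + 1 + k * d - d)) (θ - θhat) (θ' - θhat)
    rw [sub_sub_sub_cancel_right] at h1
    linarith
  have hz : 0 ≤ weightedNormSq A⁻¹ y := weightedNormSq_nonneg hA.inv y
  have h1 : inner ℝ (θ - θ') y ^ 2 ≤ 8 * b * weightedNormSq A⁻¹ y := by
    refine (sq_inner_le_weightedNormSq_inv_mul hA _ _).trans ?_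
    rw [mul_comm]
    exact mul_le_mul_of_nonneg_right hnorm hz
  have h2 : inner ℝ (θ - θ') y ^ 2 ≤ 8 * b := by
    have h3 : ‖θ‖ ≤ B := by simpa using hθ
    have h4 : ‖θ'‖ ≤ B := by simpa using hθ'
    have h5 : |inner ℝ (θ - θ') y| ≤ 2 * B * 1 := (abs_real_inner_le_norm _ _).trans
      (mul_le_mul ((norm_sub_le _ _).trans (by linarith)) hy (norm_nonneg _) (by linarith))
    have h6 := pow_le_pow_left₀ (abs_nonneg _) h5 2
    rw [sq_abs] at h6
    linarith
  have h3 : inner ℝ (θ - θ') y ^ 2 ≤ 8 * b * min 1 (weightedNormSq A⁻¹ y) := by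
    rcases min_choice 1 (weightedNormSq A⁻¹ y) with h | h <;> rw [h]
    · rwa [mul_one]
    · exact h1
  have h4 := Real.le_sqrt_of_sq_le h3
  rw [inner_sub_left, real_inner_comm y θ, real_inner_comm y θ'] at h4
  linarith

lemma bddAbove_inner_image {S : Set (EuclideanSpace ℝ (Fin p))} (hS : S ⊆ Metric.closedBall 0 B)
    (y : EuclideanSpace ℝ (Fin p)) : BddAbove ((fun θ => inner ℝ y θ) '' S) := by
  refine ⟨‖y‖ * B, ?_⟩
  rintro _ ⟨θ, hθ, rfl⟩
  have h : ‖θ‖ ≤ B := by simpa using hS hθ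
  exact (real_inner_le_norm _ _).trans (mul_le_mul_of_nonneg_left h (norm_nonneg _))

variable {Ω : Type*} {δ : ℝ} {φ : ℕ → ℝ} {d : ℕ} {D : ℕ → Set (EuclideanSpace ℝ (Fin p))}
  {θstar : EuclideanSpace ℝ (Fin p)} {ε : ℕ → Ω → ℝ} {X θhat : ℕ → Ω → EuclideanSpace ℝ (Fin p)}

lemma IsMixingLinUCB.mem (h : IsMixingLinUCB B lam δ φ d D θstar ε X θhat) {t : ℕ} (ht : 1 ≤ t)
    (ω : Ω) : X t ω ∈ D t := by
  rcases Nat.lt_or_ge d t with hdt | hdt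
  · exact h.arm_mem t hdt ω
  · obtain ⟨x, hx, hX⟩ := h.initial t ht hdt
    rwa [hX ω]

/-- The regret bound of Mixing-LinUCB on the event that all confidence sets are valid. -/
theorem IsMixingLinUCB.regret_le (h : IsMixingLinUCB B lam δ φ d D θstar ε X θhat)
    (hp : 1 ≤ p) (hd : 1 ≤ d) (hB : 0 < B) (hlam : 0 < lam)
    (hD : ∀ t, 1 ≤ t → D t ⊆ Metric.closedBall 0 1) (hθ : θstar ∈ Metric.closedBall 0 B)
    {T : ℕ} {b : ℝ} (hBb : B ^ 2 ≤ 2 * b) (ω : Ω)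
    (hmem : ∀ t, 1 ≤ t → t + d ≤ T →
      θstar ∈ confidenceSet B lam δ φ d (fun s => X s ω) t (θhat t ω))
    (hb : ∀ t : ℕ, 1 ≤ t → t + d ≤ T → (d : ℝ) * p / 2 *
          Real.log ((B + 1) ^ 2 * Real.exp 1 * max ((d : ℝ) * p) ((t : ℝ) + d) / ((d : ℝ) * p))
        + 2 * lam * B ^ 2 + t * φ d * (B + 1) + d * Real.log (d / δ) ≤ b) :
    regret D θstar X T ω ≤
      2 * B * d + √(T * (8 * b * (d * (2 * p * Real.log (p + T / lam))))) := by
  have hXD : ∀ t, 1 ≤ t → X t ω ∈ D t := fun t ht => h.mem ht ω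
  have hX1 : ∀ t, 1 ≤ t → ‖X t ω‖ ≤ 1 := fun t ht => by simpa using hD t ht (hXD t ht)
  have hθB : ‖θstar‖ ≤ B := by simpa using hθ
  have hb0 : 0 ≤ b := by nlinarith
  set A : ℕ → ℕ → Matrix (Fin p) (Fin p) ℝ := fun i k =>
    featureCov lam (residueSeq (fun s => X s ω) d i) k with hA
  set m : ℕ → ℕ → ℝ := fun i k =>
    min 1 (weightedNormSq (A i k)⁻¹ (X (i + 1 + k * d) ω)) with hm
  have hm0 : ∀ i k, 0 ≤ m i k := fun i k =>
    le_min zero_le_one (weightedNormSq_nonneg (featureCov_posDef hlam k).inv _)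
  have hinst0 : ∀ t, 1 ≤ t →
      sSup ((fun x => inner ℝ x θstar - inner ℝ (X t ω) θstar) '' D t) ≤ 2 * B := by
    intro t ht
    refine csSup_le ⟨_, Set.mem_image_of_mem _ (hXD t ht)⟩ ?_
    rintro _ ⟨y, hy, rfl⟩
    have hy1 : ‖y‖ ≤ 1 := by simpa using hD t ht hy
    have hbd : ∀ z : EuclideanSpace ℝ (Fin p), ‖z‖ ≤ 1 → |inner ℝ z θstar| ≤ B := fun z hz =>
      (abs_real_inner_le_norm _ _).trans
        ((mul_le_mul hz hθB (norm_nonneg _) zero_le_one).trans (one_mul B).le)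
    have h1 := abs_le.1 (hbd y hy1)
    have h2 := abs_le.1 (hbd _ (hX1 t ht))
    simp only
    linarith [h1.2, h2.1]
  have hinst : ∀ i < d, ∀ k, 1 ≤ k → i + 1 + k * d ≤ T →
      sSup ((fun x => inner ℝ x θstar - inner ℝ (X (i + 1 + k * d) ω) θstar) ''
        D (i + 1 + k * d)) ≤ √(8 * b * m i k) := by
    intro i hi k hk hT
    have hkd : d ≤ k * d := Nat.le_mul_of_pos_left d hk
    set t := i + 1 + k * d with ht
    have ht1 : 1 ≤ t := by omega
    have htd : d < t := by omega
    have hmem' := hmem (t - d) (by omega) (by omega)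
    have hrad := hb (t - d) (by omega) (by omega)
    refine csSup_le ⟨_, Set.mem_image_of_mem _ (hXD t ht1)⟩ ?_
    rintro _ ⟨y, hy, rfl⟩
    have hopt := h.optimistic t htd ω hy
    simp only [Set.mem_ofPred_eq] at hopt
    have hbdd := bddAbove_inner_image (B := B)
      (S := confidenceSet B lam δ φ d (fun s => X s ω) (t - d) (θhat (t - d) ω)) fun θ hθ => hθ.1
    have h1 : inner ℝ y θstar ≤
        ucb (confidenceSet B lam δ φ d (fun s => X s ω) (t - d) (θhat (t - d) ω)) y :=
      le_csSup (hbdd y) (Set.mem_image_of_mem _ hmem')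
    have h2 : ucb (confidenceSet B lam δ φ d (fun s => X s ω) (t - d) (θhat (t - d) ω)) (X t ω) ≤
        inner ℝ (X t ω) θstar + √(8 * b * m i k) := by
      refine csSup_le ⟨_, Set.mem_image_of_mem _ hmem'⟩ ?_
      rintro _ ⟨θ, hθ, rfl⟩
      exact inner_le_add_sqrt_of_mem hd hi hlam hB hBb (hX1 t ht1) hθ.1 hmem'.1
        (hθ.2.trans hrad) (hmem'.2.trans hrad)
    simp only
    linarith
  set n : ℕ → ℕ := fun i => (T + d - 1 - i) / d with hn
  have hpot : ∀ i < d, ∑ k ∈ Finset.range (n i), m i k ≤ 2 * p * Real.log (p + T / lam) := by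
    intro i _
    have h1 := sum_min_one_weightedNormSq_inv_le (x := residueSeq (fun s => X s ω) d i) hlam
      (fun s _ => hX1 _ (by omega)) hp (n i)
    have h2 : m i = fun k => min 1 (weightedNormSq (A i k)⁻¹
        (residueSeq (fun s => X s ω) d i (k + 1))) := by
      funext k
      simp [hm, residueSeq]
    rw [h2]
    refine h1.trans ?_
    have hnT : (n i : ℝ) ≤ T := by exact_mod_cast residue_count_le hd T i
    have hp0 : (1 : ℝ) ≤ p := by exact_mod_cast hp
    gcongr
  have hcard : ∑ i ∈ Finset.range d, (n i : ℝ) = T := by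
    have := sum_Icc_eq_sum_residues hd T (fun _ => (1 : ℝ))
    simpa using this.symm
  have hsqrt : ∑ i ∈ Finset.range d, ∑ k ∈ Finset.range (n i), √(8 * b * m i k) ≤
      √(T * (8 * b * (d * (2 * p * Real.log (p + T / lam))))) := by
    refine Real.le_sqrt_of_sq_le ?_
    rw [Finset.sum_sigma']
    refine sq_sum_le_card_mul_sum_sq.trans ?_
    have h1 : ((Finset.range d).sigma fun i => Finset.range (n i)).card = T := by
      rw [Finset.card_sigma]
      simp only [Finset.card_range]
      exact_mod_cast hcard
    rw [h1]
    refine mul_le_mul_of_nonneg_left ?_ (Nat.cast_nonneg _)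
    rw [Finset.sum_sigma' (Finset.range d) (fun i => Finset.range (n i))
      (fun i k => √(8 * b * m i k) ^ 2) |>.symm]
    calc ∑ i ∈ Finset.range d, ∑ k ∈ Finset.range (n i), √(8 * b * m i k) ^ 2
        = 8 * b * ∑ i ∈ Finset.range d, ∑ k ∈ Finset.range (n i), m i k := by
          simp only [Finset.mul_sum]
          refine Finset.sum_congr rfl fun i _ => Finset.sum_congr rfl fun k _ => ?_
          exact Real.sq_sqrt (mul_nonneg (by linarith) (hm0 i k))
      _ ≤ 8 * b * ∑ _i ∈ Finset.range d, 2 * p * Real.log (p + T / lam) := by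
          refine mul_le_mul_of_nonneg_left ?_ (by linarith)
          exact Finset.sum_le_sum fun i hi => hpot i (Finset.mem_range.1 hi)
      _ = _ := by simp
  rw [regret, sum_Icc_eq_sum_residues hd]
  calc ∑ i ∈ Finset.range d, ∑ k ∈ Finset.range (n i),
        sSup ((fun x => inner ℝ x θstar - inner ℝ (X (i + 1 + k * d) ω) θstar) ''
          D (i + 1 + k * d))
      ≤ ∑ i ∈ Finset.range d, ∑ k ∈ Finset.range (n i),
        -- The rounds with `k = 0` are the initial ones, with no confidence set behind them; each
        -- costs at most `2 * B`.
        ((if k = 0 then 2 * B else 0) + √(8 * b * m i k)) := by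
        refine Finset.sum_le_sum fun i hi => Finset.sum_le_sum fun k hk => ?_
        have hi' := Finset.mem_range.1 hi
        split_ifs with hk0
        · exact (hinst0 _ (by omega)).trans (le_add_of_nonneg_right (Real.sqrt_nonneg _))
        · rw [zero_add]
          exact hinst i hi' k (by omega) (residue_round_le hd hi' (Finset.mem_range.1 hk))
    _ = ∑ i ∈ Finset.range d, ∑ k ∈ Finset.range (n i), (if k = 0 then 2 * B else 0) +
        ∑ i ∈ Finset.range d, ∑ k ∈ Finset.range (n i), √(8 * b * m i k) := by
        simp only [Finset.sum_add_distrib]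
    _ ≤ ∑ _i ∈ Finset.range d, 2 * B +
        √(T * (8 * b * (d * (2 * p * Real.log (p + T / lam))))) := by
        refine add_le_add (Finset.sum_le_sum fun i _ => ?_) hsqrt
        rw [Finset.sum_ite_eq']
        split_ifs <;> linarith
    _ = _ := by simp [mul_comm]

end Regret

/-! ### The regret bound at a fixed horizon. -/

section WorstCase

variable {p : ℕ} {B C r δ : ℝ}

lemma IsWorstCaseRegretBound.mono {T : ℕ} {R R' : ℝ} (h : IsWorstCaseRegretBound.{u} p B C r δ T R)
    (hR : R ≤ R') : IsWorstCaseRegretBound.{u} p B C r δ T R' :=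
  fun Ω _ μ _ D θstar ε X θhat hD hθ hε hX =>
    (h Ω μ D θstar ε X θhat hD hθ hε hX).trans (measure_mono fun _ hω => le_trans hω hR)

/-- A non-asymptotic form of the regret bound. -/
theorem isWorstCaseRegretBound_of_le {T d : ℕ} {R L : ℝ} (hd : algebraicDelay C r T = d)
    (hp : 1 ≤ p) (hB : 0 < B) (hδ : 0 < δ) (hd1 : 1 ≤ d) (hL : 0 ≤ L)
    (hlog : ∀ t : ℕ, 1 ≤ t → t + d ≤ T → (d : ℝ) * p / 2 *
          Real.log ((B + 1) ^ 2 * Real.exp 1 * max ((d : ℝ) * p) ((t : ℝ) + d) / ((d : ℝ) * p))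
        + d * Real.log (d / δ) ≤ 2 * d * p * L)
    (hφ : algebraicRate C r d ≤ (B + 1) / 4)
    (hφL : 32 * B * L * algebraicRate C r d * (1 + 8 * p * L) ≤ 1)
    (hφT : T * algebraicRate C r d * (B + 1) + 2 ≤ 2 * d * p * L)
    (hBL : B ^ 2 ≤ 8 * d * p * L)
    (hR : 2 * B * d + √(T * (8 * (4 * d * p * L) * (d * (2 * p * Real.log (p + T * B ^ 2))))) ≤ R) :
    IsWorstCaseRegretBound.{u} p B C r δ T R := by
  intro Ω _ μ _ D θstar ε X θhat hD hθ hε hX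
  rw [hd] at hX
  have hB1 : 0 < B + 1 := by linarith
  have hd0 : (0 : ℝ) < d := by exact_mod_cast hd1
  have hlam : 0 < 1 / B ^ 2 := by positivity
  have hφ0 : 0 ≤ algebraicRate C r d := hε.rate_nonneg d hd1
  have := isProbabilityMeasure_uniformBall (E := EuclideanSpace ℝ (Fin p)) hB1
  have hXm : ∀ s, 1 ≤ s → Measurable[noiseField ε (s - d)] (X s) := by
    intro s hs
    rcases Nat.lt_or_ge d s with hds | hds
    · exact hX.adapted s hds
    · obtain ⟨x, -, hx⟩ := hX.initial s hs hds
      rw [show X s = fun _ => x from funext hx]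
      exact @measurable_const _ _ _ (noiseField ε (s - d)) x
  refine (hε.measure_residueMixture_lt hd1 hδ (uniformBall (EuclideanSpace ℝ (Fin p)) (B + 1))
    θstar hXm T).trans (measure_mono ?_)
  rintro ω ⟨hbias, hmix⟩
  have hX1 : ∀ t, 1 ≤ t → ‖X t ω‖ ≤ 1 := fun t ht => by simpa using hD t ht (hX.mem ht ω)
  -- Half of `b` covers the logarithmic terms through `hlog`; the other half covers the bias and the
  -- regularisation through `hφT`.
  refine le_trans (hX.regret_le (b := 4 * d * p * L) hp hd1 hB hlam hD hθ (by linarith) ω ?_ ?_)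
    (by rwa [div_div_eq_mul_div, div_one])
  · intro t ht htT
    refine mem_confidenceSet_of_sum_le (e := fun s => ε s ω)
      (b := fun s => noiseBias μ ε d s ω) hp hd1 hB hL
      (fun s hs => hX1 s (Finset.mem_Icc.1 hs).1) hθ (hX.leastSquares t ht ω)
      (fun s hs => hbias s (Finset.mem_Icc.1 hs).1) hφ0 (fun c hc hc1 => ?_)
      (hlog t ht htT) hφ hφL
    have hcount : ∑ i ∈ Finset.range d, (((t + d - 1 - i) / d : ℕ) : ℝ) = t := by
      have := sum_Icc_eq_sum_residues hd1 t (fun _ => (1 : ℝ))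
      simpa using this.symm
    rw [sum_Icc_eq_sum_residues hd1]
    -- Each class pays its own threshold `log (d / δ)` and its own prior cost; summing over classes
    -- gives the factors `d` of the radius.
    calc _ ≤ ∑ i ∈ Finset.range d, (Real.log (d / δ) + p * Real.log ((B + 1) / c)
          + ((t + d - 1 - i) / d : ℕ) * c ^ 2 / 2) := by
          refine Finset.sum_le_sum fun i hi => ?_
          have hlt := hmix i (Finset.mem_range.1 hi) ((t + d - 1 - i) / d)
            ((residue_count_le hd1 t i).trans (by omega))
          have hle := sum_le_of_lintegral_likelihoodRatio_lt
            (fun k _ => hX1 (i + 1 + k * d) (by omega)) (by positivity) hB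
            (hX.leastSquares t ht ω).1 hc hc1 hlt
          rwa [finrank_euclideanSpace_fin] at hle
      _ = _ := by
          rw [Finset.sum_add_distrib, ← Finset.sum_div, ← Finset.sum_mul, hcount]
          simp only [Finset.sum_const, Finset.card_range, nsmul_eq_mul]
          ring
  · intro t ht htT
    have h1 := hlog t ht htT
    have h2 : (t : ℝ) * algebraicRate C r d * (B + 1) ≤ T * algebraicRate C r d * (B + 1) := by
      have : (t : ℝ) ≤ T := by exact_mod_cast (by omega : t ≤ T)
      gcongr
    have h3 : 2 * (1 / B ^ 2) * B ^ 2 = 2 := by field_simp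
    linarith

end WorstCase

/-! ### Asymptotics in the horizon. -/

section Asymptotics

open Filter Topology Asymptotics

variable {p : ℕ} {B C r δ : ℝ}

lemma tendsto_natCast_rpow_atTop {a : ℝ} (ha : 0 < a) :
    Tendsto (fun T : ℕ => (T : ℝ) ^ a) atTop atTop :=
  (tendsto_rpow_atTop ha).comp tendsto_natCast_atTop_atTop

lemma tendsto_log_natCast_atTop : Tendsto (fun T : ℕ => Real.log T) atTop atTop :=
  Real.tendsto_log_atTop.comp tendsto_natCast_atTop_atTop

lemma le_algebraicDelay (T : ℕ) : C * (T : ℝ) ^ (1 / (1 + r)) ≤ algebraicDelay C r T :=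
  Nat.le_ceil _

lemma eventually_algebraicDelay_le (hC : 0 < C) (hr : 0 < r) :
    ∀ᶠ T : ℕ in atTop, 1 ≤ algebraicDelay C r T ∧
      (algebraicDelay C r T : ℝ) ≤ 2 * C * (T : ℝ) ^ (1 / (1 + r)) := by
  have h := (tendsto_natCast_rpow_atTop (show 0 < 1 / (1 + r) by positivity)).const_mul_atTop hC
  filter_upwards [h.eventually_ge_atTop 1] with T hT
  refine ⟨?_, ?_⟩
  · exact_mod_cast hT.trans (le_algebraicDelay (C := C) (r := r) T)
  · have := (Nat.ceil_lt_add_one (show 0 ≤ C * (T : ℝ) ^ (1 / (1 + r)) by linarith)).le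
    rw [algebraicDelay]
    linarith

lemma eventually_algebraicDelay_le_mul (hC : 0 < C) (hr : 0 < r) {a : ℝ} (ha : 0 < a) :
    ∀ᶠ T : ℕ in atTop, (algebraicDelay C r T : ℝ) ≤ a * T := by
  have hq : 0 < 1 - 1 / (1 + r) := by
    rw [sub_pos, div_lt_one (by linarith)]
    linarith
  filter_upwards [eventually_algebraicDelay_le hC hr, eventually_gt_atTop 0,
    (tendsto_natCast_rpow_atTop hq).eventually_ge_atTop (2 * C / a)] with T h1 hT h2
  have hT0 : (0 : ℝ) < T := by exact_mod_cast hT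
  rw [div_le_iff₀ ha] at h2
  calc (algebraicDelay C r T : ℝ) ≤ 2 * C * (T : ℝ) ^ (1 / (1 + r)) := h1.2
    _ ≤ (T : ℝ) ^ (1 - 1 / (1 + r)) * a * (T : ℝ) ^ (1 / (1 + r)) := by gcongr
    _ = a * ((T : ℝ) ^ (1 - 1 / (1 + r)) * (T : ℝ) ^ (1 / (1 + r))) := by ring
    _ = a * T := by rw [← Real.rpow_add hT0, sub_add_cancel, Real.rpow_one]

/-- With the delay `d = ⌈C T ^ (1 / (1 + r))⌉`, the accumulated bias `T φ_d` is of order `d`. -/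
lemma mul_algebraicRate_algebraicDelay_le (hC : 0 < C) (hr : 0 < r) {T : ℕ}
    (hd : 1 ≤ algebraicDelay C r T) :
    T * algebraicRate C r (algebraicDelay C r T) ≤ C ^ (-r) * algebraicDelay C r T := by
  have hle := le_algebraicDelay (C := C) (r := r) T
  set d : ℝ := (algebraicDelay C r T : ℝ) with hddef
  have hd0 : 0 < d := by
    have : (1 : ℝ) ≤ d := by rw [hddef]; exact_mod_cast hd
    linarith
  have hT0 : (0 : ℝ) ≤ T := Nat.cast_nonneg T
  -- The delay is chosen for this: its power `1 + r` dominates a multiple of `T`, so `T * d ^ (-r)`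
  -- is at most a multiple of `d`.
  have h1 : C ^ (1 + r) * T ≤ d ^ (1 + r) := by
    have h2 := Real.rpow_le_rpow (by positivity) hle (show 0 ≤ 1 + r by linarith)
    rwa [Real.mul_rpow hC.le (by positivity), ← Real.rpow_mul hT0,
      one_div_mul_cancel (by linarith), Real.rpow_one] at h2
  have h3 : C ^ (1 + r) * C ^ (-r) = C := by
    rw [← Real.rpow_add hC]; simp
  have h4 : d ^ (1 + r) * d ^ (-r) = d := by
    rw [← Real.rpow_add hd0]; simp
  calc T * algebraicRate C r (algebraicDelay C r T)
      = (C ^ (1 + r) * T) * (C ^ (-r) * d ^ (-r)) := by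
        rw [algebraicRate, ← hddef]
        nth_rewrite 1 [← h3]
        ring
    _ ≤ d ^ (1 + r) * (C ^ (-r) * d ^ (-r)) := by gcongr
    _ = C ^ (-r) * (d ^ (1 + r) * d ^ (-r)) := by ring
    _ = C ^ (-r) * d := by rw [h4]

lemma algebraicRate_algebraicDelay_le (hC : 0 < C) (hr : 0 < r) {T : ℕ} (hT : 1 ≤ T) :
    algebraicRate C r (algebraicDelay C r T) ≤ C * C ^ (-r) * (T : ℝ) ^ (-(r / (1 + r))) := by
  have hT0 : (0 : ℝ) < T := by exact_mod_cast hT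
  have hle := le_algebraicDelay (C := C) (r := r) T
  have h1 := Real.rpow_le_rpow_of_nonpos (by positivity) hle (show -r ≤ 0 by linarith)
  rw [Real.mul_rpow hC.le (by positivity), ← Real.rpow_mul hT0.le] at h1
  rw [algebraicRate, mul_assoc]
  refine mul_le_mul_of_nonneg_left (h1.trans (le_of_eq ?_)) hC.le
  congr 2
  ring

lemma tendsto_rpow_neg_mul_log_sq {a : ℝ} (ha : 0 < a) :
    Tendsto (fun T : ℕ => (T : ℝ) ^ (-a) * Real.log T ^ 2) atTop (𝓝 0) := by
  have h1 := (isLittleO_log_rpow_atTop (show 0 < a / 2 by positivity)).tendsto_div_nhds_zero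
  have h2 := (h1.comp tendsto_natCast_atTop_atTop).pow 2
  rw [zero_pow two_ne_zero] at h2
  refine h2.congr' ?_
  filter_upwards [eventually_gt_atTop 0] with T hT
  have hT0 : (0 : ℝ) < T := by exact_mod_cast hT
  simp only [Function.comp]
  rw [div_pow, ← Real.rpow_mul_natCast hT0.le, Real.rpow_neg hT0.le]
  norm_num
  ring

/-- With `L = log T`, the smallness condition used for coverage is quadratic in `L`, hence the
square. -/
lemma tendsto_algebraicRate_mul_log_sq (hC : 0 < C) (hr : 0 < r) :
    Tendsto (fun T : ℕ => algebraicRate C r (algebraicDelay C r T) * Real.log T ^ 2)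
      atTop (𝓝 0) := by
  have h := (tendsto_rpow_neg_mul_log_sq (show 0 < r / (1 + r) by positivity)).const_mul
    (C * C ^ (-r))
  rw [mul_zero] at h
  refine tendsto_of_tendsto_of_tendsto_of_le_of_le' tendsto_const_nhds h ?_ ?_
  · refine Eventually.of_forall fun T => ?_
    unfold algebraicRate
    positivity
  · filter_upwards [eventually_ge_atTop 1] with T hT
    rw [← mul_assoc]
    exact mul_le_mul_of_nonneg_right (algebraicRate_algebraicDelay_le hC hr hT) (sq_nonneg _)

lemma eventually_half_log_le_log_mul_div (hp : 1 ≤ p) (hB : 0 < B) :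
    ∀ᶠ T : ℕ in atTop, Real.log T / 2 ≤ Real.log (T * B / p) := by
  have hp0 : (0 : ℝ) < p := by exact_mod_cast hp
  filter_upwards [eventually_gt_atTop 0,
    tendsto_log_natCast_atTop.eventually_ge_atTop (-2 * Real.log (B / p))] with T hT h
  have hT0 : (0 : ℝ) < T := by exact_mod_cast hT
  rw [mul_div_assoc, Real.log_mul hT0.ne' (by positivity)]
  linarith

/-- The single term `p log (T B / p)` already dominates the regret bound; the two square roots are
only needed to be nonnegative. -/
lemma eventually_le_algebraicRegretRate (hp : 1 ≤ p) (hB : 0 < B) (hC : 0 < C) (hr : 0 < r) :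
    ∀ᶠ T : ℕ in atTop, C * ((T : ℝ) ^ (1 / (1 + r)) * √T) * (p * Real.log T) / 2 ≤
      algebraicRegretRate p B C r δ T := by
  filter_upwards [eventually_half_log_le_log_mul_div hp hB, eventually_gt_atTop 0] with T h hT
  have hT0 : (0 : ℝ) < T := by exact_mod_cast hT
  have hexp : (3 + r) / (2 * (1 + r)) = 1 / (1 + r) + 1 / 2 := by field_simp; ring
  rw [algebraicRegretRate, hexp, Real.rpow_add hT0, ← Real.sqrt_eq_rpow]
  set Q := C * ((T : ℝ) ^ (1 / (1 + r)) * √T) with hQ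
  have hQ0 : 0 ≤ Q := by positivity
  have h1 : p * Real.log T / 2 ≤ p * Real.log (T * B / p)
      + √(B * p * Real.log ((T : ℝ) ^ (r / (1 + r)) * B / (C * p)))
      + √(p * Real.log (T * B / (p * δ))) := by
    have h2 : p * (Real.log T / 2) ≤ p * Real.log (T * B / p) :=
      mul_le_mul_of_nonneg_left h (Nat.cast_nonneg p)
    have h3 := Real.sqrt_nonneg (B * p * Real.log ((T : ℝ) ^ (r / (1 + r)) * B / (C * p)))
    have h4 := Real.sqrt_nonneg (p * Real.log (T * B / (p * δ)))
    linarith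
  have h5 : 0 ≤ C * B * (T : ℝ) ^ (1 / (1 + r)) := by positivity
  have h6 := mul_le_mul_of_nonneg_left h1 hQ0
  linarith

/-- Both logarithmic terms of the confidence radius are of order `d p log T`. -/
lemma confidence_log_le {d t T : ℕ} (hp : 1 ≤ p) (hd : 1 ≤ d) (hB : 0 < B) (hδ : 0 < δ)
    (hdp : (d : ℝ) * p ≤ T) (hdδ : (d : ℝ) ≤ δ * T) (hBT : (B + 1) ^ 2 * Real.exp 1 ≤ T)
    (htT : t + d ≤ T) :
    (d : ℝ) * p / 2 *
        Real.log ((B + 1) ^ 2 * Real.exp 1 * max ((d : ℝ) * p) ((t : ℝ) + d) / ((d : ℝ) * p))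
      + d * Real.log (d / δ) ≤ 2 * d * p * Real.log T := by
  have hd0 : (1 : ℝ) ≤ d := by exact_mod_cast hd
  have hp0 : (1 : ℝ) ≤ p := by exact_mod_cast hp
  have hdp1 : (1 : ℝ) ≤ d * p := one_le_mul_of_one_le_of_one_le hd0 hp0
  have hT1 : (1 : ℝ) ≤ T := hdp1.trans hdp
  have hmax : max ((d : ℝ) * p) ((t : ℝ) + d) ≤ T := max_le hdp (by exact_mod_cast htT)
  have hmax0 : 0 < max ((d : ℝ) * p) ((t : ℝ) + d) := lt_max_of_lt_left (by linarith)
  have h1 : Real.log ((B + 1) ^ 2 * Real.exp 1 * max ((d : ℝ) * p) ((t : ℝ) + d) / (d * p)) ≤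
      2 * Real.log T := by
    have h2 : (2 : ℝ) * Real.log T = Real.log ((T : ℝ) * T) := by
      rw [Real.log_mul (by linarith) (by linarith)]; ring
    rw [h2]
    refine Real.log_le_log (by positivity) ((div_le_self (by positivity) hdp1).trans ?_)
    exact mul_le_mul hBT hmax hmax0.le (by linarith)
  have h3 : Real.log (d / δ) ≤ Real.log T := by
    refine Real.log_le_log (by positivity) ?_
    rwa [div_le_iff₀ hδ, mul_comm]
  have hL0 : 0 ≤ Real.log T := Real.log_nonneg hT1
  have h4 : (d : ℝ) * p / 2 * Real.log ((B + 1) ^ 2 * Real.exp 1 *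
      max ((d : ℝ) * p) ((t : ℝ) + d) / (d * p)) ≤ d * p / 2 * (2 * Real.log T) :=
    mul_le_mul_of_nonneg_left h1 (by positivity)
  have h5 : d * Real.log (d / δ) ≤ d * p * Real.log T := by
    refine (mul_le_mul_of_nonneg_left h3 (by linarith)).trans ?_
    exact mul_le_mul_of_nonneg_right (le_mul_of_one_le_right (by linarith) hp0) hL0
  linarith

theorem eventually_isWorstCaseRegretBound (hp : 1 ≤ p) (hB : 0 < B) (hC : 0 < C) (hr : 0 < r)
    (hδ : 0 < δ) : ∀ᶠ T : ℕ in atTop,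
      IsWorstCaseRegretBound.{u} p B C r δ T (52 * algebraicRegretRate p B C r δ T) := by
  have hp0 : (1 : ℝ) ≤ p := by exact_mod_cast hp
  have hconst : 0 < min ((B + 1) / 4) (1 / (32 * B * (1 + 8 * p))) :=
    lt_min (by positivity) (by positivity)
  filter_upwards [eventually_algebraicDelay_le hC hr,
    eventually_algebraicDelay_le_mul hC hr (show (0 : ℝ) < 1 / p by positivity),
    eventually_algebraicDelay_le_mul hC hr hδ,
    tendsto_natCast_atTop_atTop.eventually_ge_atTop ((B + 1) ^ 2 * Real.exp 1),
    tendsto_natCast_atTop_atTop.eventually_ge_atTop (p + B ^ 2 : ℝ),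
    (tendsto_algebraicRate_mul_log_sq hC hr).eventually_le_const hconst,
    tendsto_log_natCast_atTop.eventually_ge_atTop 1,
    tendsto_log_natCast_atTop.eventually_ge_atTop (C ^ (-r) * (B + 1) + 2),
    tendsto_log_natCast_atTop.eventually_ge_atTop (B ^ 2),
    tendsto_log_natCast_atTop.eventually_ge_atTop (2 * B),
    eventually_le_algebraicRegretRate (δ := δ) hp hB hC hr]
    with T hd hdp hdδ hBT hpBT hφ hL1 hLC hLB2 hLB hrate
  obtain ⟨hd1, hdC⟩ := hd
  have hφT := mul_algebraicRate_algebraicDelay_le hC hr hd1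
  obtain ⟨d, hdd⟩ : ∃ d, d = algebraicDelay C r T := ⟨_, rfl⟩
  rw [← hdd] at hd1 hdC hdp hdδ hφ hφT
  have hd0 : (1 : ℝ) ≤ d := by exact_mod_cast hd1
  have hT0 : (0 : ℝ) ≤ T := Nat.cast_nonneg T
  have hT1 : (1 : ℝ) ≤ T := by nlinarith [sq_nonneg B]
  have hdp1 : (1 : ℝ) ≤ d * p := one_le_mul_of_one_le_of_one_le hd0 hp0
  set L := Real.log T with hL
  set φ := algebraicRate C r d with hφdef
  have hφ0 : 0 ≤ φ := by rw [hφdef, algebraicRate]; positivity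
  have hdL : d * L ≤ d * p * L := by
    refine mul_le_mul_of_nonneg_right ?_ (by linarith)
    exact le_mul_of_one_le_right (by linarith) hp0
  have hLd : L ≤ d * p * L := le_mul_of_one_le_left (by linarith) hdp1
  refine isWorstCaseRegretBound_of_le (d := d) (L := L) hdd.symm hp hB hδ hd1 (by linarith)
    (fun t _ htT => confidence_log_le hp hd1 hB hδ ?_ hdδ hBT htT) ?_ ?_ ?_ ?_ ?_
  · rw [one_div, inv_mul_eq_div, le_div_iff₀ (by linarith)] at hdp
    exact hdp
  · calc φ ≤ φ * L ^ 2 := le_mul_of_one_le_right hφ0 (one_le_pow₀ hL1)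
      _ ≤ _ := hφ.trans (min_le_left _ _)
  · have h1 := hφ.trans (min_le_right _ _)
    rw [le_div_iff₀ (by positivity)] at h1
    refine le_trans ?_ h1
    have h2 : L ≤ L ^ 2 := by nlinarith
    have h3 : 0 ≤ 32 * B * φ := by positivity
    have h4 := mul_le_mul_of_nonneg_left h2 h3
    linarith
  · have h1 : T * φ * (B + 1) ≤ C ^ (-r) * d * (B + 1) :=
      mul_le_mul_of_nonneg_right hφT (by linarith)
    have h2 : (C ^ (-r) * (B + 1) + 2) * d ≤ L * d :=
      mul_le_mul_of_nonneg_right hLC (by linarith)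
    linarith
  · linarith
  · have hlog : Real.log (p + T * B ^ 2) ≤ 2 * L := by
      have h1 : (2 : ℝ) * L = Real.log ((T : ℝ) * T) := by
        rw [Real.log_mul (by linarith) (by linarith)]; ring
      rw [h1]
      refine Real.log_le_log (by positivity) ?_
      calc (p : ℝ) + T * B ^ 2 ≤ T * p + T * B ^ 2 := by
            have : (p : ℝ) ≤ T * p := le_mul_of_one_le_left (by linarith) hT1
            linarith
        _ = T * (p + B ^ 2) := by ring
        _ ≤ T * T := mul_le_mul_of_nonneg_left hpBT hT0
    -- The constant `52` is `(12 + 1) * 2 * 2`: `12 ≥ √128` from here, `1` from the initial rounds,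
    -- `2` from rounding the delay up, and `2` from the lower bound on the rate.
    have hsqrt : √(T * (8 * (4 * d * p * L) * (d * (2 * p * Real.log (p + T * B ^ 2))))) ≤
        12 * (d * p * L * √T) := by
      refine Real.sqrt_le_iff.2 ⟨by positivity, ?_⟩
      have h1 : (12 * (d * p * L * √T)) ^ 2 = 144 * (d * p * L) ^ 2 * T := by
        rw [mul_pow, mul_pow, Real.sq_sqrt hT0]; ring
      rw [h1]
      calc T * (8 * (4 * d * p * L) * (d * (2 * p * Real.log (p + T * B ^ 2))))
          ≤ T * (8 * (4 * d * p * L) * (d * (2 * p * (2 * L)))) := by gcongr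
        _ = 128 * ((d * p * L) ^ 2 * T) := by ring
        _ ≤ 144 * ((d * p * L) ^ 2 * T) := by gcongr; norm_num
        _ = _ := by ring
    have hsT : 1 ≤ √(T : ℝ) := Real.one_le_sqrt.2 hT1
    have hfirst : 2 * B * d ≤ d * p * L * √T := by
      calc 2 * B * d ≤ L * d := mul_le_mul_of_nonneg_right hLB (by linarith)
        _ ≤ d * p * L := by linarith
        _ ≤ d * p * L * √T := le_mul_of_one_le_right (by positivity) hsT
    have hlast : d * p * L * √T ≤ 2 * C * (T : ℝ) ^ (1 / (1 + r)) * (p * L * √T) := by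
      calc d * p * L * √T = d * (p * L * √T) := by ring
        _ ≤ _ := mul_le_mul_of_nonneg_right hdC (by positivity)
    linarith

lemma isBigO_log_rpow_mul {a k : ℝ} (hk : 0 < k) :
    (fun T : ℕ => Real.log ((T : ℝ) ^ a * k)) =O[atTop] fun T : ℕ => Real.log T := by
  refine IsBigO.of_bound (|a| + |Real.log k|) ?_
  filter_upwards [eventually_gt_atTop 0, tendsto_log_natCast_atTop.eventually_ge_atTop 1]
    with T hT hL
  have hT0 : (0 : ℝ) < T := by exact_mod_cast hT
  rw [Real.log_mul (by positivity) hk.ne', Real.log_rpow hT0, Real.norm_eq_abs, Real.norm_eq_abs,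
    abs_of_nonneg (show 0 ≤ Real.log T by linarith), add_mul]
  refine (abs_add_le _ _).trans (add_le_add ?_ (le_mul_of_one_le_right (abs_nonneg _) hL))
  rw [abs_mul, abs_of_nonneg (show 0 ≤ Real.log T by linarith)]

lemma isBigO_sqrt_log {f : ℕ → ℝ} (hf : f =O[atTop] fun T : ℕ => Real.log T) :
    (fun T => √(f T)) =O[atTop] fun T : ℕ => Real.log T := by
  obtain ⟨c, hc⟩ := hf.bound
  refine IsBigO.of_bound (1 + c) ?_
  filter_upwards [hc, tendsto_log_natCast_atTop.eventually_ge_atTop 1] with T h hL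
  rw [Real.norm_eq_abs, Real.norm_eq_abs, abs_of_nonneg (show 0 ≤ Real.log T by linarith)] at h
  rw [Real.norm_eq_abs, Real.norm_eq_abs, abs_of_nonneg (show 0 ≤ Real.log T by linarith),
    abs_of_nonneg (Real.sqrt_nonneg _)]
  have h1 : √(f T) ≤ 1 + |f T| := by
    refine Real.sqrt_le_iff.2 ⟨by positivity, ?_⟩
    nlinarith [le_abs_self (f T), abs_nonneg (f T)]
  linarith

lemma isLittleO_mul_rpow_mul {s c : ℝ} (hs : s < 1) {f : ℕ → ℝ}
    (hf : f =O[atTop] fun T : ℕ => Real.log T) :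
    (fun T : ℕ => c * (T : ℝ) ^ s * f T) =o[atTop] fun T : ℕ => (T : ℝ) := by
  have hlo : (fun T : ℕ => Real.log T) =o[atTop] fun T : ℕ => (T : ℝ) ^ (1 - s) :=
    (isLittleO_log_rpow_atTop (sub_pos.2 hs)).comp_tendsto tendsto_natCast_atTop_atTop
  have hpow : (fun T : ℕ => c * (T : ℝ) ^ s) =O[atTop] fun T : ℕ => (T : ℝ) ^ s :=
    (isBigO_refl _ _).const_mul_left c
  refine (hpow.mul_isLittleO (hf.trans_isLittleO hlo)).congr' (Eventually.of_forall fun T => rfl) ?_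
  filter_upwards [eventually_gt_atTop 0] with T hT
  rw [← Real.rpow_add (by exact_mod_cast hT), add_sub_cancel, Real.rpow_one]

lemma algebraicRegretRate_isLittleO (hp : 1 ≤ p) (hB : 0 < B) (hC : 0 < C) (hr : 1 < r)
    (hδ : 0 < δ) :
    (fun T : ℕ => algebraicRegretRate p B C r δ T) =o[atTop] fun T : ℕ => (T : ℝ) := by
  have hp0 : (0 : ℝ) < p := by exact_mod_cast hp
  set s := (3 + r) / (2 * (1 + r)) with hs
  -- This exponent is below `1` exactly when `r > 1`; the logarithmic factors are then harmless.
  have hs1 : s < 1 := by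
    rw [hs, div_lt_one (by linarith)]
    linarith
  have hq1 : 1 / (1 + r) < 1 := by
    rw [div_lt_one (by linarith)]
    linarith
  have hfirst : (fun T : ℕ => C * B * (T : ℝ) ^ (1 / (1 + r))) =o[atTop] fun T : ℕ => (T : ℝ) := by
    have hone : (fun _ : ℕ => (1 : ℝ)) =O[atTop] fun T : ℕ => Real.log T := by
      refine IsBigO.of_bound 1 ?_
      filter_upwards [tendsto_log_natCast_atTop.eventually_ge_atTop 1] with T hL
      simpa using hL.trans (le_abs_self _)
    simpa using isLittleO_mul_rpow_mul (c := C * B) hq1 hone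
  have hlog : ∀ k : ℝ, 0 < k →
      (fun T : ℕ => Real.log ((T : ℝ) * k)) =O[atTop] fun T : ℕ => Real.log T := fun k hk => by
    simpa using isBigO_log_rpow_mul (a := 1) hk
  have h1 : (fun T : ℕ => p * Real.log (T * B / p)) =O[atTop] fun T : ℕ => Real.log T := by
    simp only [mul_div_assoc]
    exact (hlog _ (by positivity)).const_mul_left _
  have h2 : (fun T : ℕ => √(B * p * Real.log ((T : ℝ) ^ (r / (1 + r)) * B / (C * p)))) =O[atTop]
      fun T : ℕ => Real.log T := by
    simp only [mul_div_assoc]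
    exact isBigO_sqrt_log ((isBigO_log_rpow_mul (by positivity)).const_mul_left _)
  have h3 : (fun T : ℕ => √(p * Real.log (T * B / (p * δ)))) =O[atTop]
      fun T : ℕ => Real.log T := by
    simp only [mul_div_assoc]
    exact isBigO_sqrt_log ((hlog _ (by positivity)).const_mul_left _)
  exact hfirst.add (isLittleO_mul_rpow_mul hs1 ((h1.add h2).add h3))

end Asymptotics

theorem corollary3 :
    ∃ K : ℝ, 0 < K ∧
      ∀ (p : ℕ) (B C r δ : ℝ), 1 ≤ p → 0 < B → 0 < C → 0 < r → 0 < δ → δ < 1 →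
        (∃ T₀ : ℕ, ∀ T : ℕ, T₀ ≤ T →
          IsWorstCaseRegretBound.{u} p B C r δ T (K * algebraicRegretRate p B C r δ T)) ∧
        (1 < r →
          (fun T : ℕ => algebraicRegretRate p B C r δ T) =o[Filter.atTop] (fun T : ℕ => (T : ℝ)) ∧
          ∀ η : ℝ, 0 < η → ∃ T₀ : ℕ, ∀ T : ℕ, T₀ ≤ T →
            IsWorstCaseRegretBound.{u} p B C r δ T (η * T)) := by
  refine ⟨52, by norm_num, fun p B C r δ hp hB hC hr hδ _ => ?_⟩
  have hbound := eventually_isWorstCaseRegretBound.{u} hp hB hC hr hδ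
  refine ⟨Filter.eventually_atTop.1 hbound, fun hr1 => ?_⟩
  have hlittle := algebraicRegretRate_isLittleO hp hB hC hr1 hδ
  refine ⟨hlittle, fun η hη => Filter.eventually_atTop.1 ?_⟩
  filter_upwards [hbound, hlittle.bound (show 0 < η / 52 by positivity)] with T h1 h2
  refine h1.mono ?_
  rw [Real.norm_eq_abs, Real.norm_eq_abs, abs_of_nonneg (Nat.cast_nonneg T : (0 : ℝ) ≤ T)] at h2
  linarith [le_abs_self (algebraicRegretRate p B C r δ T)]
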